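/- Let $K$ be a field. A *curve* over $K$ is a nonsingular, projective, geometrically irreducible one-dimensional variety over $K$, and a *cover* of curves over $K$ is a nonconstant separable morphism (over $K$) between curves over $K$; its degree is the degree of the corresponding extension of function fields. A cover is *decomposable* if it is the composition of two covers of curves over $K$ which both have degree at least $2$, and *indecomposable* if it has degree at least $2$ and is not decomposable. The *monodromy group* $\mathrm{Mon}(\phi)$ of a cover $\phi\colon C\to D$ is the Galois group of the Galois closure of the function field extension $K(C)/K(D)$, viewed as a group of permutations of the set of embeddings over $K(D)$ of $K(C)$ into a fixed algebraic closure of $K(D)$. A *Dedekind group* is a group all of whose subgroups are normal. Two permutation groups $G$ on $X$ and $H$ on $Y$ are *isomorphic as permutation groups* if there are a bijection $e\colon X\to Y$ and a group isomorphism $\theta\colon G\to H$ with $e(g x)=\theta(g)e(x)$ for all $g\in G$, $x\in X$. **Proposition.** Let $\phi\colon C\to D$ be a cover of curves over $K$ such that $\mathrm{Mon}(\phi)$ has a transitive subgroup which is a Dedekind group. Let $\phi=\phi_2\circ\phi_1=\psi_2\circ\psi_1$ be two complete decompositions of $\phi$, that is, $\phi_1\colon C\to C_1$, $\phi_2\colon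 C_1\to D$, $\psi_1\colon C\to B_1$, $\psi_2\colon B_1\to D$ are indecomposable covers of curves over $K$. Suppose that the two decompositions are inequivalent, that is, there is no isomorphism $\rho\colon C_1\to B_1$ over $K$ with $\psi_1=\rho\circ\phi_1$ and $\psi_2\circ\rho=\phi_2$. Then $\mathrm{Mon}(\phi_2)\cong\mathrm{Mon}(\psi_1)$ and $\mathrm{Mon}(\phi_1)\cong\mathrm{Mon}(\psi_2)$ as permutation groups. -/

import Mathlib

open CategoryTheory AlgebraicGeometry

universe u

noncomputable section

namespace CurveCover

/-! ### Permutation groups -/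

/-- A Dedekind group: every subgroup is normal. -/
def IsDedekindGroup (A : Type*) [Group A] : Prop :=
  ∀ B : Subgroup A, B.Normal

/-- A permutation group `G` on `X` has a transitive Dedekind subgroup. -/
def HasTransitiveDedekindSubgroup {X : Type*} (G : Subgroup (Equiv.Perm X)) : Prop :=
  ∃ A : Subgroup (Equiv.Perm X), A ≤ G ∧ MulAction.IsPretransitive A X ∧ IsDedekindGroup A

/-- Isomorphism of permutation groups: a bijection of the underlying sets together with an
isomorphism of the groups that intertwines the two actions. -/
def PermIsomorphic {X Y : Type*} (G : Subgroup (Equiv.Perm X)) (H : Subgroup (Equiv.Perm Y)) :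
    Prop :=
  ∃ (e : X ≃ Y) (θ : G ≃* H), ∀ (g : G) (x : X),
    e ((g : Equiv.Perm X) x) = (θ g : Equiv.Perm Y) (e x)

/-! ### The Galois group of the Galois closure, as a permutation group -/

section Galois

variable (F L : Type*) [Field F] [Field L] [Algebra F L]

/-- The embeddings of `L` over `F` into the fixed algebraic closure of `F`. -/
abbrev Embeddings : Type _ := L →ₐ[F] AlgebraicClosure F

/-- The normal closure of `L / F` inside the fixed algebraic closure of `F`; it is the Galois
closure of `L / F` when `L / F` is separable. -/
abbrev galoisClosure : IntermediateField F (AlgebraicClosure F) :=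
  IntermediateField.normalClosure F L (AlgebraicClosure F)

/-- The action of the Galois group of the Galois closure on the embeddings: all embeddings take
values in the Galois closure, and `σ` sends the embedding `f` to `σ ∘ f`. -/
def galoisAction :
    (galoisClosure F L ≃ₐ[F] galoisClosure F L) →* Equiv.Perm (Embeddings F L) where
  toFun σ :=
    { toFun := fun f => normalClosure.algHomEquiv F L (AlgebraicClosure F)
        ((σ : galoisClosure F L →ₐ[F] galoisClosure F L).comp
          ((normalClosure.algHomEquiv F L (AlgebraicClosure F)).symm f))
      invFun := fun f => normalClosure.algHomEquiv F L (AlgebraicClosure F)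
        ((σ.symm : galoisClosure F L →ₐ[F] galoisClosure F L).comp
          ((normalClosure.algHomEquiv F L (AlgebraicClosure F)).symm f))
      left_inv := fun f => by
        dsimp only
        rw [Equiv.symm_apply_apply, ← AlgHom.comp_assoc, AlgEquiv.symm_comp, AlgHom.id_comp,
          Equiv.apply_symm_apply]
      right_inv := fun f => by
        dsimp only
        rw [Equiv.symm_apply_apply, ← AlgHom.comp_assoc, AlgEquiv.comp_symm, AlgHom.id_comp,
          Equiv.apply_symm_apply] }
  map_one' := by
    ext f x
    rfl
  map_mul' σ τ := by
    apply Equiv.ext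
    intro f
    change _ = normalClosure.algHomEquiv F L (AlgebraicClosure F) _
    simp only [Equiv.coe_fn_mk, Equiv.symm_apply_apply]
    rfl

/-- The Galois group of the Galois closure of `L / F`, as a group of permutations of the set of
embeddings of `L` over `F` into the algebraic closure of `F`. -/
def galoisPermGroup : Subgroup (Equiv.Perm (Embeddings F L)) :=
  (galoisAction F L).range

end Galois

/-! ### Curves and covers over a field -/

section Curves

variable (K : Type u) [Field K]

/-- The grading of the polynomial ring in `m` variables by degree. -/
instance polynomialGrading (m : ℕ) :
    GradedAlgebra (MvPolynomial.homogeneousSubmodule (Fin m) K) :=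
  MvPolynomial.gradedAlgebra

/-- Projective `n`-space over `K`. -/
def projSpace (n : ℕ) : Over (Spec (CommRingCat.of K)) :=
  Over.mk (Proj.toSpecZero (MvPolynomial.homogeneousSubmodule (Fin (n + 1)) K) ≫
    Spec.map (CommRingCat.ofHom
      (algebraMap K (MvPolynomial.homogeneousSubmodule (Fin (n + 1)) K 0))))

variable {K}

/-- A curve over `K`: a nonsingular, projective, geometrically irreducible one-dimensional variety
over `K`. (Separatedness and finiteness of type are part of projectivity.) -/
class IsCurve (X : Over (Spec (CommRingCat.of K))) : Prop where
  integral : IsIntegral X.left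
  dim_eq_one : topologicalKrullDim X.left = 1
  nonsingular : ∀ x : X.left, IsRegularLocalRing (X.left.presheaf.stalk x)
  geometricallyIrreducible : GeometricallyIrreducible X.hom
  projective : ∃ (n : ℕ) (i : X ⟶ projSpace K n), IsClosedImmersion i.left

instance (X : Over (Spec (CommRingCat.of K))) [h : IsCurve X] : IsIntegral X.left := h.integral

/-- A morphism is nonconstant if its image is not a single point. -/
def IsNonconstant {C D : Over (Spec (CommRingCat.of K))} (f : C ⟶ D) : Prop :=
  ¬ ∃ y : D.left, ∀ x : C.left, f.left x = y

/-- A nonconstant morphism of curves maps the generic point to the generic point. -/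
theorem IsNonconstant.map_genericPoint {C D : Over (Spec (CommRingCat.of K))} [IsCurve C]
    [hD : IsCurve D] {f : C ⟶ D} (hf : IsNonconstant f) :
    f.left (genericPoint C.left) = genericPoint D.left := by
  set y := f.left (genericPoint C.left) with hy
  let Z : TopologicalSpace.IrreducibleCloseds D.left :=
    ⟨closure {y}, isIrreducible_singleton.closure, isClosed_closure⟩
  have hdim : Order.krullDim (TopologicalSpace.IrreducibleCloseds D.left) ≤ 1 :=
    hD.dim_eq_one.le
  rcases Order.krullDim_le_one_iff.mp hdim Z with hmin | hmax
  · refine absurd ⟨y, fun x => ?_⟩ hf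
    have h1 : y ⤳ f.left x := (genericPoint_specializes x).map f.left.continuous
    let W : TopologicalSpace.IrreducibleCloseds D.left :=
      ⟨closure {f.left x}, isIrreducible_singleton.closure, isClosed_closure⟩
    have h2 : W ≤ Z := h1.closure_subset
    have h3 : Z ≤ W := hmin h2
    have h4 : f.left x ⤳ y := specializes_iff_closure_subset.mpr h3
    exact (h4.antisymm h1).eq
  · let T : TopologicalSpace.IrreducibleCloseds D.left :=
      ⟨Set.univ, IrreducibleSpace.isIrreducible_univ _, isClosed_univ⟩
    have h1 : T ≤ Z := hmax (b := T) (Set.subset_univ _)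
    have h2 : y ⤳ genericPoint D.left :=
      specializes_iff_mem_closure.mpr (h1 (Set.mem_univ _))
    exact (h2.antisymm (genericPoint_specializes y)).eq

/-- The map of function fields `K(D) → K(C)`, `g ↦ g ∘ f`, of a nonconstant morphism. -/
def functionFieldMap {C D : Over (Spec (CommRingCat.of K))} [IsCurve C] [IsCurve D] (f : C ⟶ D)
    (hf : IsNonconstant f) : D.left.functionField →+* C.left.functionField :=
  (D.left.presheaf.stalkSpecializes (specializes_of_eq hf.map_genericPoint) ≫
    f.left.stalkMap (genericPoint C.left)).hom

/-- `K(C)` as an extension of `K(D)`. -/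
abbrev functionFieldAlgebra {C D : Over (Spec (CommRingCat.of K))} [IsCurve C] [IsCurve D]
    (f : C ⟶ D) (hf : IsNonconstant f) : Algebra D.left.functionField C.left.functionField :=
  (functionFieldMap f hf).toAlgebra

/-- A cover of curves over `K`: a nonconstant separable morphism over `K`. -/
class IsCover {C D : Over (Spec (CommRingCat.of K))} [IsCurve C] [IsCurve D] (f : C ⟶ D) :
    Prop where
  nonconstant : IsNonconstant f
  separable : letI := functionFieldAlgebra f nonconstant
    Algebra.IsSeparable D.left.functionField C.left.functionField

/-- The degree of a cover, `[K(C) : K(D)]`. -/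
def degree {C D : Over (Spec (CommRingCat.of K))} [IsCurve C] [IsCurve D] (f : C ⟶ D)
    [hf : IsCover f] : ℕ :=
  letI := functionFieldAlgebra f hf.nonconstant
  Module.finrank D.left.functionField C.left.functionField

/-- The set permuted by the monodromy group: the embeddings of `K(C)` over `K(D)` into an algebraic
closure of `K(D)`. -/
def MonodromySet {C D : Over (Spec (CommRingCat.of K))} [IsCurve C] [IsCurve D] (f : C ⟶ D)
    [hf : IsCover f] : Type u :=
  letI := functionFieldAlgebra f hf.nonconstant
  Embeddings D.left.functionField C.left.functionField

/-- The monodromy group of a cover: the Galois group of the Galois closure of `K(C) / K(D)`, as a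
permutation group. -/
def Mon {C D : Over (Spec (CommRingCat.of K))} [IsCurve C] [IsCurve D] (f : C ⟶ D)
    [hf : IsCover f] : Subgroup (Equiv.Perm (MonodromySet f)) :=
  letI := functionFieldAlgebra f hf.nonconstant
  galoisPermGroup D.left.functionField C.left.functionField

/-- A cover is decomposable if it is the composition of two covers of curves over `K`, both of
degree at least two. -/
def IsDecomposable {C D : Over (Spec (CommRingCat.of K))} [IsCurve C] [IsCurve D] (f : C ⟶ D) :
    Prop :=
  ∃ (E : Over (Spec (CommRingCat.of K))) (_ : IsCurve E) (g : C ⟶ E) (h : E ⟶ D)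
    (_ : IsCover g) (_ : IsCover h), g ≫ h = f ∧ 2 ≤ degree g ∧ 2 ≤ degree h

/-- A cover is indecomposable if its degree is at least two and it is not decomposable. -/
def IsIndecomposable {C D : Over (Spec (CommRingCat.of K))} [IsCurve C] [IsCurve D] (f : C ⟶ D)
    [IsCover f] : Prop :=
  2 ≤ degree f ∧ ¬ IsDecomposable f

/-- `f = f₂ ∘ f₁` is a complete decomposition (of length two). -/
structure IsCompleteDecomposition {C E D : Over (Spec (CommRingCat.of K))} [IsCurve C] [IsCurve E]
    [IsCurve D] (f : C ⟶ D) (f₁ : C ⟶ E) (f₂ : E ⟶ D) [IsCover f₁] [IsCover f₂] : Prop where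
  comp_eq : f₁ ≫ f₂ = f
  indecomposable_fst : IsIndecomposable f₁
  indecomposable_snd : IsIndecomposable f₂

/-- The decompositions `f₂ ∘ f₁` and `g₂ ∘ g₁` of the same cover `C ⟶ D` are equivalent: there is
an isomorphism `ρ` of the intermediate curves over `K` with `g₁ = ρ ∘ f₁` and `g₂ ∘ ρ = f₂`. -/
def AreEquivalent {C E B D : Over (Spec (CommRingCat.of K))} (f₁ : C ⟶ E) (f₂ : E ⟶ D)
    (g₁ : C ⟶ B) (g₂ : B ⟶ D) : Prop :=
  ∃ ρ : E ≅ B, g₁ = f₁ ≫ ρ.hom ∧ ρ.hom ≫ g₂ = f₂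

end Curves

end CurveCover

end

noncomputable section

namespace CurveCover

/-! ### Permutation groups -/

/-! Put F = K(D), M = K(C), and let L₁, L₂ be the images of K(C₁), K(B₁) in M. The problem moves to
M/F by two facts: an indecomposable cover has no proper intermediate field
(`IsIndecomposable.eq_bot_or_eq_top`), and decompositions with the same intermediate field are
equivalent (`areEquivalent_of_fieldRange_eq`). Hence L₁ ≠ L₂, L₁ ∩ L₂ = F and L₁L₂ = M.

Field theory (`permIsomorphic_galoisPermGroup`). Let N be the Galois closure, G = Gal(N/F), x an
embedding of M into N, A the transitive Dedekind group on such embeddings, and Pᵢ ≤ A the stabilizer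
of x|Lᵢ. As Pᵢ is normal in A and A is transitive, Pᵢ fixes every restriction to Lᵢ of an embedding
of M. The set P₁P₂x = P₂P₁x is stable under the stabilizers in G of x|L₁ and x|L₂. These generate G
because L₁ ∩ L₂ = F, so P₁P₂x contains all embeddings. Restriction to L₁ is then a bijection from
the embeddings of M extending x|L₂ to the embeddings of L₁: it is injective since L₁L₂ = M, and
surjective since pqx and qx agree on L₁. The same factorization shows that Gal(N/L₂) and G induce
the same permutations of the embeddings of L₁, so Mon(φ₂) ≅ Mon(ψ₁).

Geometry. An intermediate field E is realised by the normalization of D in E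
(`exists_isCurve_of_functionField`). Separability makes it finite over D with Dedekind coordinate
rings, and surjectivity of C onto it gives geometric irreducibility. Projectivity holds because it
is affine over a projective space and proper (`exists_isClosedImmersion_of_isAffineHom`). Morphisms
of curves are recovered from maps of function fields through normality of the source
(`exists_lift_of_isIntegralHom`). -/

theorem permIsomorphic_of_forall_exists {X Y : Type*} {G : Subgroup (Equiv.Perm X)}
    {H : Subgroup (Equiv.Perm Y)} (e : X ≃ Y)
    (h₁ : ∀ g ∈ G, ∃ h ∈ H, ∀ x, e (g x) = h (e x))
    (h₂ : ∀ h ∈ H, ∃ g ∈ G, ∀ x, e (g x) = h (e x)) : PermIsomorphic G H := by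
  have hmap : G.map (e.permCongrHom : Equiv.Perm X →* Equiv.Perm Y) = H := by
    ext h
    simp only [Subgroup.mem_map, MonoidHom.coe_coe]
    constructor
    · rintro ⟨g, hg, rfl⟩
      obtain ⟨h, hh, hgh⟩ := h₁ g hg
      convert hh
      ext y
      simpa [Equiv.permCongrHom] using hgh (e.symm y)
    · intro hh
      obtain ⟨g, hg, hgh⟩ := h₂ h hh
      refine ⟨g, hg, ?_⟩
      ext y
      simpa [Equiv.permCongrHom] using hgh (e.symm y)
  refine ⟨e, (e.permCongrHom.subgroupMap G).trans (MulEquiv.subgroupCongr hmap), fun g x => ?_⟩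
  change _ = e ((g : Equiv.Perm X) (e.symm (e x)))
  rw [e.symm_apply_apply]

theorem PermIsomorphic.symm {X Y : Type*} {G : Subgroup (Equiv.Perm X)}
    {H : Subgroup (Equiv.Perm Y)} (h : PermIsomorphic G H) : PermIsomorphic H G := by
  obtain ⟨e, θ, h⟩ := h
  refine ⟨e.symm, θ.symm, fun g y => ?_⟩
  rw [Equiv.symm_apply_eq, h]
  simp

theorem PermIsomorphic.trans {X Y Z : Type*} {G : Subgroup (Equiv.Perm X)}
    {H : Subgroup (Equiv.Perm Y)} {I : Subgroup (Equiv.Perm Z)} (h : PermIsomorphic G H)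
    (h' : PermIsomorphic H I) : PermIsomorphic G I := by
  obtain ⟨e, θ, h⟩ := h
  obtain ⟨e', θ', h'⟩ := h'
  exact ⟨e.trans e', θ.trans θ', fun g y => by simp [h, h']⟩

theorem HasTransitiveDedekindSubgroup.of_permIsomorphic {X Y : Type*}
    {G : Subgroup (Equiv.Perm X)} {H : Subgroup (Equiv.Perm Y)}
    (hG : HasTransitiveDedekindSubgroup G) (h : PermIsomorphic G H) :
    HasTransitiveDedekindSubgroup H := by
  obtain ⟨A, hA, htrans, hded⟩ := hG
  obtain ⟨e, θ, h⟩ := h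
  let ε : A ≃* A.map (e.permCongrHom : Equiv.Perm X →* Equiv.Perm Y) :=
    e.permCongrHom.subgroupMap A
  refine ⟨A.map (e.permCongrHom : Equiv.Perm X →* Equiv.Perm Y), ?_, ⟨fun y z => ?_⟩, ?_⟩
  · rintro _ ⟨a, ha, rfl⟩
    convert (θ ⟨a, hA ha⟩).2
    ext y
    simpa [Equiv.permCongrHom] using h ⟨a, hA ha⟩ (e.symm y)
  · obtain ⟨a, ha⟩ := htrans.exists_smul_eq (e.symm y) (e.symm z)
    refine ⟨ε a, ?_⟩
    have : e ((a : Equiv.Perm X) (e.symm y)) = z := by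
      rw [← Equiv.eq_symm_apply]; exact ha
    exact this
  · intro B
    have hn := hded (B.comap ε.toMonoidHom)
    have := hn.map ε.toMonoidHom ε.surjective
    rwa [Subgroup.map_comap_eq_self_of_surjective ε.surjective] at this

/-! ### Embeddings into a normal extension -/

section Galois

variable (F L N : Type*) [Field F] [Field L] [Field N] [Algebra F L] [Algebra F N]

/-- The action of the automorphisms of `N` on the embeddings of `L` into `N`. -/
def embeddingAction : (N ≃ₐ[F] N) →* Equiv.Perm (L →ₐ[F] N) where
  toFun σ :=
    { toFun := fun f => (σ : N →ₐ[F] N).comp f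
      invFun := fun f => (σ.symm : N →ₐ[F] N).comp f
      left_inv := fun f => by ext; simp
      right_inv := fun f => by ext; simp }
  map_one' := by ext; rfl
  map_mul' σ τ := by ext; rfl

variable {F L N}

@[simp]
theorem embeddingAction_apply_apply (σ : N ≃ₐ[F] N) (f : L →ₐ[F] N) (x : L) :
    embeddingAction F L N σ f x = σ (f x) := rfl

theorem galoisAction_apply_apply (σ : galoisClosure F L ≃ₐ[F] galoisClosure F L)
    (f : Embeddings F L) (x : L) :
    galoisAction F L σ f x =
      σ ((normalClosure.algHomEquiv F L (AlgebraicClosure F)).symm f x) := rfl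

theorem coe_algHomEquiv_symm_apply (f : Embeddings F L) (x : L) :
    ((normalClosure.algHomEquiv F L (AlgebraicClosure F)).symm f x : AlgebraicClosure F) = f x :=
  rfl

/-- Automorphisms of the normal closure lift to the algebraic closure, and those of the algebraic
closure restrict, without changing the action on embeddings. -/
theorem galoisPermGroup_eq_range [Algebra.IsAlgebraic F L] :
    galoisPermGroup F L = (embeddingAction F L (AlgebraicClosure F)).range := by
  ext π
  constructor
  · rintro ⟨σ, rfl⟩
    refine ⟨σ.liftNormal (AlgebraicClosure F), ?_⟩
    ext f x
    rw [embeddingAction_apply_apply, galoisAction_apply_apply, ← coe_algHomEquiv_symm_apply]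
    exact (AlgEquiv.liftNormal_commutes σ (AlgebraicClosure F)
      ((normalClosure.algHomEquiv F L (AlgebraicClosure F)).symm f x)).symm ▸ rfl
  · rintro ⟨σ, rfl⟩
    refine ⟨σ.restrictNormal (galoisClosure F L), ?_⟩
    ext f x
    rw [embeddingAction_apply_apply, galoisAction_apply_apply, ← coe_algHomEquiv_symm_apply]
    exact AlgEquiv.restrictNormal_commutes σ (galoisClosure F L) _

/-- The embedding `g` forces the minimal polynomial of every `x : L` to split in `N`, so its root `f
x` already lies in the image of `N`. -/
theorem exists_comp_eq_of_normal {Ω : Type*} [Field Ω] [Algebra F Ω] [Normal F N]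
    (g : L →ₐ[F] N) (κ : N →ₐ[F] Ω) (f : L →ₐ[F] Ω) : ∃ f' : L →ₐ[F] N, κ.comp f' = f := by
  have key : f.range ≤ κ.range := by
    rintro _ ⟨x, rfl⟩
    have hx := Normal.isIntegral (F := F) (K := N) inferInstance (g x)
    have hs := Normal.splits (F := F) (K := N) inferInstance (g x)
    have hm : minpoly F (g x) = minpoly F x := minpoly.algHom_eq g g.injective x
    have h0 := minpoly.ne_zero hx
    rw [hm] at hs h0
    have hr : ((Polynomial.map (algebraMap F N) (minpoly F x)).map κ.toRingHom).IsRoot (f x) := by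
      rw [Polynomial.map_map, Polynomial.IsRoot.def, AlgHom.toRingHom_eq_coe, κ.comp_algebraMap,
        Polynomial.eval_map_algebraMap, Polynomial.aeval_algHom_apply, minpoly.aeval, map_zero]
    exact hs.mem_range_of_isRoot (by simpa [Polynomial.map_ne_zero_iff] using h0) hr
  refine ⟨(AlgEquiv.ofInjective κ κ.injective).symm.toAlgHom.comp
    ((Subalgebra.inclusion key).comp f.rangeRestrict), ?_⟩
  ext x
  have := (AlgEquiv.ofInjective κ κ.injective).apply_symm_apply
    (Subalgebra.inclusion key (f.rangeRestrict x))
  exact congrArg Subtype.val this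

/-- The embeddings into a normal extension are permuted as those into the algebraic closure. -/
theorem permIsomorphic_range_embeddingAction [Normal F N] (g : L →ₐ[F] N) :
    PermIsomorphic (embeddingAction F L N).range (galoisPermGroup F L) := by
  have : Algebra.IsAlgebraic F L := Algebra.IsAlgebraic.of_injective g g.injective
  rw [galoisPermGroup_eq_range]
  let κ : N →ₐ[F] AlgebraicClosure F := IsAlgClosed.lift
  let := κ.toRingHom.toAlgebra
  have : IsScalarTower F N (AlgebraicClosure F) := .of_algebraMap_eq' κ.comp_algebraMap.symm
  have hκ : Function.Bijective (fun f : L →ₐ[F] N => κ.comp f) :=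
    ⟨fun f f' h => by
      ext x
      exact κ.injective (DFunLike.congr_fun h x), fun f => exists_comp_eq_of_normal g κ f⟩
  refine permIsomorphic_of_forall_exists (Equiv.ofBijective _ hκ) ?_ ?_
  · rintro _ ⟨σ, rfl⟩
    refine ⟨_, ⟨σ.liftNormal (AlgebraicClosure F), rfl⟩, fun f => ?_⟩
    ext x
    exact (AlgEquiv.liftNormal_commutes σ (AlgebraicClosure F) (f x)).symm
  · rintro _ ⟨σ, rfl⟩
    refine ⟨_, ⟨σ.restrictNormal N, rfl⟩, fun f => ?_⟩
    ext x
    exact AlgEquiv.restrictNormal_commutes σ N (f x)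

end Galois

/-! ### Transitive Dedekind groups and two subfields with trivial intersection. -/

section TwoSubfields

variable {F L₁ L₂ M : Type*} [Field F] [Field L₁] [Field L₂] [Field M] [Algebra F L₁]
  [Algebra F L₂] [Algebra F M] {N : Type*} [Field N] [Algebra F N]

/-- The stabilizer of `x|L` in a transitive Dedekind group acts trivially on the embeddings
of `L`. -/
theorem restrict_eq_of_isDedekindGroup {A : Subgroup (Equiv.Perm (M →ₐ[F] N))}
    (hA : A ≤ (embeddingAction F M N).range) (htrans : MulAction.IsPretransitive A (M →ₐ[F] N))
    (hded : IsDedekindGroup A) (i : L₁ →ₐ[F] M) (x : M →ₐ[F] N) (a : A)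
    (ha : ((a : Equiv.Perm _) x).comp i = x.comp i) (y : M →ₐ[F] N) :
    ((a : Equiv.Perm _) y).comp i = y.comp i := by
  have hres : ∀ (b : A) (f g : M →ₐ[F] N), f.comp i = g.comp i →
      ((b : Equiv.Perm _) f).comp i = ((b : Equiv.Perm _) g).comp i := by
    intro b f g h
    obtain ⟨σ, hσ⟩ := hA b.2
    ext l
    rw [← hσ]
    exact congrArg σ (DFunLike.congr_fun h l)
  let P : Subgroup A :=
    { carrier := {a | ((a : Equiv.Perm _) x).comp i = x.comp i}
      one_mem' := rfl
      mul_mem' := fun {a b} ha hb => (hres a _ _ hb).trans ha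
      inv_mem' := fun {a} ha => by
        have := hres a⁻¹ _ _ ha
        simpa using this.symm }
  -- Writing y = bx moves the question to `x`, where b⁻¹ab lies in the stabilizer `P` by normality.
  obtain ⟨b, rfl⟩ := htrans.exists_smul_eq x y
  have h1 : b⁻¹ * a * b⁻¹⁻¹ ∈ P := (hded P).conj_mem a ha b⁻¹
  have h2 := hres b _ _ h1
  simpa [Subgroup.smul_def] using h2

/-- Membership in the product of stabilizers, one step. -/
theorem exists_embeddingAction_mul_apply_eq {A : Subgroup (Equiv.Perm (M →ₐ[F] N))}
    (hA : A ≤ (embeddingAction F M N).range) (htrans : MulAction.IsPretransitive A (M →ₐ[F] N))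
    (i₁ : L₁ →ₐ[F] M) (i₂ : L₂ →ₐ[F] M) (x : M →ₐ[F] N) (σ : N ≃ₐ[F] N) (p q : A)
    (hσ : (embeddingAction F M N σ x).comp i₁ = x.comp i₁)
    (hp : ((p : Equiv.Perm _) x).comp i₁ = x.comp i₁)
    (hq : ((q : Equiv.Perm _) x).comp i₂ = x.comp i₂) :
    ∃ p' q' : A, ((p' : Equiv.Perm _) x).comp i₁ = x.comp i₁ ∧
      ((q' : Equiv.Perm _) x).comp i₂ = x.comp i₂ ∧
      embeddingAction F M N σ ((p : Equiv.Perm _) ((q : Equiv.Perm _) x)) =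
        (p' : Equiv.Perm _) ((q' : Equiv.Perm _) x) := by
  obtain ⟨τ, hτ⟩ := hA p.2
  -- Transitivity supplies p' in `A` with p'x = σpx. Then p'⁻¹σp fixes `x`, so it preserves the set
  -- of embeddings that agree with `x` on L₂; q' is chosen to realise its value at qx.
  obtain ⟨p', hp'⟩ := htrans.exists_smul_eq x (embeddingAction F M N (σ * τ) x)
  obtain ⟨τ', hτ'⟩ := hA p'.2
  obtain ⟨q', hq'⟩ := htrans.exists_smul_eq x
    (embeddingAction F M N (τ'⁻¹ * (σ * τ)) ((q : Equiv.Perm _) x))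
  have hp'x : (p' : Equiv.Perm _) x = embeddingAction F M N (σ * τ) x := hp'
  have hq'x : (q' : Equiv.Perm _) x =
    embeddingAction F M N (τ'⁻¹ * (σ * τ)) ((q : Equiv.Perm _) x) := hq'
  have hfix : embeddingAction F M N (τ'⁻¹ * (σ * τ)) x = x := by
    rw [map_mul, Equiv.Perm.mul_apply, ← hp'x, ← hτ', ← Equiv.Perm.mul_apply, ← map_mul,
      inv_mul_cancel, map_one, Equiv.Perm.one_apply]
  refine ⟨p', q', ?_, ?_, ?_⟩
  · rw [hp'x, map_mul, Equiv.Perm.mul_apply, hτ, ← hσ]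
    ext l
    exact congrArg σ (DFunLike.congr_fun hp l)
  · rw [hq'x]
    nth_rw 2 [← hfix]
    ext l
    exact congrArg (τ'⁻¹ * (σ * τ) : N ≃ₐ[F] N) (DFunLike.congr_fun hq l)
  · rw [hq'x, ← hτ', ← hτ, map_mul, map_mul, map_inv]
    simp

/-- This is pq = q(q⁻¹pq) together with normality of the stabilizer; it lets the two stabilizers
change places in a product. -/
theorem exists_mul_apply_eq_swap {A : Subgroup (Equiv.Perm (M →ₐ[F] N))}
    (hA : A ≤ (embeddingAction F M N).range) (htrans : MulAction.IsPretransitive A (M →ₐ[F] N))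
    (hded : IsDedekindGroup A) (i : L₁ →ₐ[F] M) (x : M →ₐ[F] N) (p q : A)
    (hp : ((p : Equiv.Perm _) x).comp i = x.comp i) :
    ∃ p' : A, ((p' : Equiv.Perm _) x).comp i = x.comp i ∧
      (p : Equiv.Perm _) ((q : Equiv.Perm _) x) = (q : Equiv.Perm _) ((p' : Equiv.Perm _) x) := by
  refine ⟨q⁻¹ * p * q, ?_, by simp⟩
  have h1 := restrict_eq_of_isDedekindGroup hA htrans hded i x p hp ((q : Equiv.Perm _) x)
  obtain ⟨τ, hτ⟩ := hA (q⁻¹).2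
  have h2 : (embeddingAction F M N τ ((p : Equiv.Perm _) ((q : Equiv.Perm _) x))).comp i =
      (embeddingAction F M N τ ((q : Equiv.Perm _) x)).comp i := by
    ext l
    exact congrArg τ (DFunLike.congr_fun h1 l)
  rw [hτ] at h2
  simpa using h2

/-- If `L₁ ∩ L₂ = F`, then the stabilizers in a transitive Dedekind group of the restrictions of
`x` to `L₁` and `L₂` generate a transitive group. -/
theorem exists_mul_apply_eq [FiniteDimensional F N] [IsGalois F N]
    {A : Subgroup (Equiv.Perm (M →ₐ[F] N))}
    (hA : A ≤ (embeddingAction F M N).range) (htrans : MulAction.IsPretransitive A (M →ₐ[F] N))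
    (hded : IsDedekindGroup A) (i₁ : L₁ →ₐ[F] M) (i₂ : L₂ →ₐ[F] M)
    (hinf : i₁.fieldRange ⊓ i₂.fieldRange = ⊥) (x y : M →ₐ[F] N) :
    ∃ p q : A, ((p : Equiv.Perm _) x).comp i₁ = x.comp i₁ ∧
      ((q : Equiv.Perm _) x).comp i₂ = x.comp i₂ ∧
      (p : Equiv.Perm _) ((q : Equiv.Perm _) x) = y := by
  -- `Z` is the set P₁P₂x, and `W` below is its setwise stabilizer in Gal(N/F). The goal is W = ⊤,
  -- since Gal(N/F) is transitive on embeddings.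
  let Z : Set (M →ₐ[F] N) := {z | ∃ p q : A, ((p : Equiv.Perm _) x).comp i₁ = x.comp i₁ ∧
      ((q : Equiv.Perm _) x).comp i₂ = x.comp i₂ ∧
      (p : Equiv.Perm _) ((q : Equiv.Perm _) x) = z}
  let W : Subgroup (N ≃ₐ[F] N) :=
    { carrier := {σ | ∀ z, embeddingAction F M N σ z ∈ Z ↔ z ∈ Z}
      one_mem' := fun z => by simp
      mul_mem' := fun {σ τ} hσ hτ z => by
        rw [map_mul, Equiv.Perm.mul_apply, hσ, hτ]
      inv_mem' := fun {σ} hσ z => by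
        rw [← hσ, ← Equiv.Perm.mul_apply, ← map_mul, mul_inv_cancel, map_one,
          Equiv.Perm.one_apply] }
  have hle : ∀ H : Subgroup (N ≃ₐ[F] N),
      (∀ σ ∈ H, ∀ z ∈ Z, embeddingAction F M N σ z ∈ Z) → H ≤ W := by
    intro H hH σ hσ z
    refine ⟨fun h => ?_, hH σ hσ z⟩
    have := hH σ⁻¹ (inv_mem hσ) _ h
    rwa [← Equiv.Perm.mul_apply, ← map_mul, inv_mul_cancel, map_one, Equiv.Perm.one_apply] at this
  have h₁ : (x.comp i₁).fieldRange.fixingSubgroup ≤ W := by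
    refine hle _ ?_
    rintro σ hσ _ ⟨p, q, hp, hq, rfl⟩
    obtain ⟨p', q', hp', hq', h⟩ := exists_embeddingAction_mul_apply_eq hA htrans i₁ i₂ x σ p q (by
      ext l
      exact (IntermediateField.mem_fixingSubgroup_iff _ _).mp hσ _ ⟨l, rfl⟩) hp hq
    exact ⟨p', q', hp', hq', h.symm⟩
  have h₂ : (x.comp i₂).fieldRange.fixingSubgroup ≤ W := by
    refine hle _ ?_
    rintro σ hσ _ ⟨p, q, hp, hq, rfl⟩
    -- The one-step lemma absorbs σ into the left factor, so the product is rewritten in P₂P₁x,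
    -- treated there, and rewritten back.
    obtain ⟨p₁, hp₁, h⟩ := exists_mul_apply_eq_swap hA htrans hded i₁ x p q hp
    obtain ⟨q', p', hq', hp', h'⟩ := exists_embeddingAction_mul_apply_eq hA htrans i₂ i₁ x σ q p₁ (by
      ext l
      exact (IntermediateField.mem_fixingSubgroup_iff _ _).mp hσ _ ⟨l, rfl⟩) hq hp₁
    obtain ⟨q₁, hq₁, h''⟩ := exists_mul_apply_eq_swap hA htrans hded i₂ x q' p' hq'
    exact ⟨p', q₁, hp', hq₁, by rw [h, h', h'']⟩
  have hbot : (x.comp i₁).fieldRange ⊓ (x.comp i₂).fieldRange = ⊥ := by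
    rw [eq_bot_iff]
    rintro _ ⟨⟨a, rfl⟩, ⟨b, hb⟩⟩
    have hab : i₂ b = i₁ a := x.injective hb
    have : i₁ a ∈ i₁.fieldRange ⊓ i₂.fieldRange := ⟨⟨a, rfl⟩, ⟨b, hab⟩⟩
    rw [hinf, IntermediateField.mem_bot] at this
    obtain ⟨c, hc⟩ := this
    rw [IntermediateField.mem_bot]
    exact ⟨c, by simp [← hc]⟩
  have htop : W = ⊤ := by
    have h := le_antisymm (a := (x.comp i₁).fieldRange ⊓ (x.comp i₂).fieldRange) (b := ⊥)
      hbot.le bot_le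
    -- By the Galois correspondence the fixed field of `W` lies in x(L₁) ∩ x(L₂) = F.
    have h3 : IntermediateField.fixedField W ≤ ⊥ := by
      rw [← hbot]
      refine le_inf ?_ ?_
      · rw [← IsGalois.fixedField_fixingSubgroup (x.comp i₁).fieldRange]
        exact IntermediateField.fixedField_antitone h₁
      · rw [← IsGalois.fixedField_fixingSubgroup (x.comp i₂).fieldRange]
        exact IntermediateField.fixedField_antitone h₂
    rw [← IntermediateField.fixingSubgroup_fixedField W, eq_bot_iff.mpr h3,
      IntermediateField.fixingSubgroup_bot]
  obtain ⟨a, ha⟩ := htrans.exists_smul_eq x y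
  obtain ⟨σ, hσ⟩ := hA a.2
  have hσW : σ ∈ W := htop ▸ Subgroup.mem_top σ
  have hx : x ∈ Z := ⟨1, 1, rfl, rfl, rfl⟩
  have := (hσW x).mpr hx
  rw [hσ] at this
  rwa [← ha]

/-- Both groups are realised inside the single normal extension `N` of `F`, where restriction to L₁
compares the embeddings of `M` over L₂ with those of L₁ over `F`. -/
theorem permIsomorphic_galoisPermGroup [Algebra L₁ M] [Algebra L₂ M] [IsScalarTower F L₁ M]
    [IsScalarTower F L₂ M] [FiniteDimensional F M] [Algebra.IsSeparable F M]
    (hM : HasTransitiveDedekindSubgroup (galoisPermGroup F M))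
    (hinf : (IsScalarTower.toAlgHom F L₁ M).fieldRange ⊓
      (IsScalarTower.toAlgHom F L₂ M).fieldRange = ⊥)
    (hsup : (IsScalarTower.toAlgHom F L₁ M).fieldRange ⊔
      (IsScalarTower.toAlgHom F L₂ M).fieldRange = ⊤) :
    PermIsomorphic (galoisPermGroup F L₁) (galoisPermGroup L₂ M) := by
  let i₁ := IsScalarTower.toAlgHom F L₁ M
  let i₂ := IsScalarTower.toAlgHom F L₂ M
  let N := galoisClosure F M
  let x : M →ₐ[F] N := (normalClosure.algHomEquiv F M (AlgebraicClosure F)).symm IsAlgClosed.lift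
  have : IsGalois F N := by
    have (f : M →ₐ[F] AlgebraicClosure F) : Algebra.IsSeparable F f.fieldRange :=
      .of_equiv_equiv (RingEquiv.refl F)
        (AlgEquiv.ofInjective f f.injective).toRingEquiv
        (RingHom.ext fun c => Subtype.ext (f.commutes c).symm)
    have : Algebra.IsSeparable F N := IntermediateField.isSeparable_iSup F (AlgebraicClosure F)
    have : Normal F N := inferInstanceAs (Normal F (galoisClosure F M))
    constructor
  have : Algebra.IsAlgebraic L₁ M := .tower_top (K := F) L₁
  -- `N` becomes an L₂-algebra through `x`, so that the L₂-embeddings of `M` are exactly the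
  -- extensions of x|L₂.
  let := (x.comp i₂).toRingHom.toAlgebra
  have : IsScalarTower F L₂ N := .of_algebraMap_eq' (x.comp i₂).comp_algebraMap.symm
  have : Normal L₂ N := Normal.tower_top_of_normal F L₂ N
  let x' : M →ₐ[L₂] N := { x with commutes' := fun _ => rfl }
  obtain ⟨A, hA, htrans, hded⟩ :=
    hM.of_permIsomorphic (permIsomorphic_range_embeddingAction x).symm
  refine ((permIsomorphic_range_embeddingAction x').symm.trans (PermIsomorphic.trans ?_
    (permIsomorphic_range_embeddingAction (x.comp i₁)))).symm
  have hbij : Function.Bijective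
      (fun f : M →ₐ[L₂] N => (f.restrictScalars F).comp i₁) := by
    refine ⟨fun f g h => ?_, fun y₁ => ?_⟩
    -- Two L₂-embeddings agreeing on L₁ are equalized on the compositum, which is `M`.
    · have hle : (i₁.fieldRange ⊔ i₂.fieldRange).toSubalgebra ≤
          AlgHom.equalizer (f.restrictScalars F) (g.restrictScalars F) := by
        rw [IntermediateField.sup_toSubalgebra_of_isAlgebraic_left]
        refine sup_le ?_ ?_
        · rintro _ ⟨l, rfl⟩
          exact DFunLike.congr_fun h l
        · rintro _ ⟨l, rfl⟩
          exact (f.commutes l).trans (g.commutes l).symm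
      rw [hsup] at hle
      ext m
      exact congrArg Subtype.val (hle (IntermediateField.mem_top (x := m)))
    · obtain ⟨y', hy'⟩ := IsAlgClosed.surjective_domRestrict_of_isAlgebraic (K := F) (L := L₁)
        (E := M) (M := AlgebraicClosure F) (N.val.comp y₁)
      obtain ⟨y, hy⟩ := exists_comp_eq_of_normal x N.val y'
      have hy₁ : y.comp i₁ = y₁ := by
        ext l
        have h1 := DFunLike.congr_fun hy (i₁ l)
        have h2 := DFunLike.congr_fun hy' l
        exact h1.trans h2
      -- With y = pqx an extension of y₁, the factor p is invisible on L₁, and qx is L₂-linear: qx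
      -- is the required preimage.
      obtain ⟨p, q, hp, hq, hpq⟩ := exists_mul_apply_eq hA htrans hded i₁ i₂ hinf x y
      refine ⟨{ (q : Equiv.Perm _) x with commutes' := fun l => DFunLike.congr_fun hq l }, ?_⟩
      rw [← hy₁, ← hpq, restrict_eq_of_isDedekindGroup hA htrans hded i₁ x p hp]
      rfl
  refine permIsomorphic_of_forall_exists (Equiv.ofBijective _ hbij) ?_ ?_
  · rintro _ ⟨σ, rfl⟩
    exact ⟨_, ⟨σ.restrictScalars F, rfl⟩, fun f => rfl⟩
  · rintro _ ⟨σ, rfl⟩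
    -- Here σx = qpx in the opposite order. With τ inducing p, the automorphism τ⁻¹σ fixes x(L₂)
    -- because q is invisible on L₂, and it acts on embeddings of L₁ as σ does because τ is
    -- invisible there.
    obtain ⟨q, p, hq, hp, hpq⟩ := exists_mul_apply_eq hA htrans hded i₂ i₁
      ((inf_comm i₂.fieldRange i₁.fieldRange).trans hinf) x (embeddingAction F M N σ x)
    obtain ⟨τ, hτ⟩ := hA p.2
    have hfix : ∀ l : L₂, (τ⁻¹ * σ) (algebraMap L₂ N l) = algebraMap L₂ N l := by
      intro l
      have h1 := restrict_eq_of_isDedekindGroup hA htrans hded i₂ x q hq ((p : Equiv.Perm _) x)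
      rw [hpq, ← hτ] at h1
      exact (AlgEquiv.symm_apply_eq τ).mpr (DFunLike.congr_fun h1 l)
    refine ⟨_, ⟨{ (τ⁻¹ * σ : N ≃ₐ[F] N) with commutes' := hfix }, rfl⟩, fun f => ?_⟩
    have h1 := restrict_eq_of_isDedekindGroup hA htrans hded i₁ x p hp
      (embeddingAction F M N (τ⁻¹ * σ) (f.restrictScalars F))
    rw [← hτ, ← Equiv.Perm.mul_apply, ← map_mul, mul_inv_cancel_left] at h1
    ext l
    exact congrArg Subtype.val (DFunLike.congr_fun h1.symm l)

end TwoSubfields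

/-! ### Local structure of curves -/

/-- Regularity bounds the number of generators of the maximal ideal by the dimension, so that ideal
is principal. -/
theorem isPrincipalIdealRing_of_isRegularLocalRing {R : Type*} [CommRing R] [IsDomain R]
    [hR : IsRegularLocalRing R] (h : ringKrullDim R ≤ 1) : IsPrincipalIdealRing R := by
  have hp : (IsLocalRing.maximalIdeal R).IsPrincipal := by
    have hle : (IsLocalRing.maximalIdeal R).spanFinrank ≤ 1 := by
      have := hR.spanFinrank_maximalIdeal.le.trans h
      exact_mod_cast this
    rcases Nat.le_one_iff_eq_zero_or_eq_one.mp hle with h0 | h1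
    · rw [Submodule.spanFinrank_eq_zero_iff_eq_bot (IsNoetherian.noetherian _)] at h0
      rw [h0]
      infer_instance
    · exact ((Submodule.spanFinrank_eq_one_iff _).mp h1).1
  exact ((tfae_of_isNoetherianRing_of_isLocalRing_of_isDomain R).out 0 4).mpr hp

section Scheme

variable {X : Scheme.{u}}

/-- In the specialization order the generic point is the top element, so coheight is codimension,
equal to the dimension of the stalk. -/
theorem coheight_le_one_of_topologicalKrullDim_le_one (h : topologicalKrullDim X ≤ 1) (x : X) :
    Order.coheight x ≤ 1 := by
  rw [← Order.coheight_orderIso (irreducibleSetEquivPoints (α := X)).symm x]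
  have := (Order.coheight_le_krullDim ((irreducibleSetEquivPoints (α := X)).symm x)).trans h
  exact_mod_cast this

theorem topologicalKrullDim_eq_one [IsIntegral X] (h : ∀ x : X, Order.coheight x ≤ 1) (hX : Nontrivial X) :
    topologicalKrullDim X = 1 := by
  have e : topologicalKrullDim X = Order.krullDim X :=
    Order.krullDim_eq_of_orderIso (irreducibleSetEquivPoints (α := X))
  rw [e]
  apply le_antisymm
  · rw [Order.krullDim_eq_iSup_coheight]
    exact iSup_le fun x => by exact_mod_cast h x
  · obtain ⟨x, hx⟩ := exists_ne (⊤ : X)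
    rw [Order.one_le_krullDim_iff]
    exact ⟨x, genericPoint X, genericPoint_specializes x, fun h => hx
      (Specializes.antisymm (y := genericPoint X) h (genericPoint_specializes x)).eq⟩

/-- The localizations at nonzero primes are stalks, hence principal ideal domains that are not
fields. -/
theorem isDedekindDomain_of_isAffineOpen [IsIntegral X] [IsLocallyNoetherian X]
    (h : ∀ x : X, IsPrincipalIdealRing (X.presheaf.stalk x)) {U : X.Opens} (hU : IsAffineOpen U)
    [Nonempty U] : IsDedekindDomain Γ(X, U) := by
  have : IsNoetherianRing Γ(X, U) := IsLocallyNoetherian.component_noetherian ⟨U, hU⟩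
  have : IsDedekindDomainDvr Γ(X, U) := by
    refine ⟨fun P hP hprime => ?_⟩
    let x : X := hU.fromSpec ⟨P, hprime⟩
    have hx : x ∈ U := (hU.isoSpec.inv ⟨P, hprime⟩).2
    let := TopCat.Presheaf.algebra_section_stalk X.presheaf (⟨x, hx⟩ : U)
    have hloc : IsLocalization.AtPrime (X.presheaf.stalk x) P :=
      hU.isLocalization_stalk' ⟨P, hprime⟩ hx
    let e := IsLocalization.algEquiv P.primeCompl (X.presheaf.stalk x) (Localization.AtPrime P)
    have : IsPrincipalIdealRing (Localization.AtPrime P) :=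
      .of_surjective e.toRingEquiv.toRingHom e.surjective
    exact { not_a_field' := fun h => IsLocalization.AtPrime.not_isField _ hP (Localization.AtPrime P)
              (IsLocalRing.isField_iff_maximalIdeal_eq.mpr h) }
  infer_instance

theorem isRegularLocalRing_stalk_of_isDedekindDomain {U : X.Opens} (hU : IsAffineOpen U)
    (hD : IsDedekindDomain Γ(X, U)) {x : X} (hx : x ∈ U) :
    IsRegularLocalRing (X.presheaf.stalk x) := by
  have := hU.isLocalization_stalk ⟨x, hx⟩
  let P := (hU.primeIdealOf ⟨x, hx⟩).asIdeal
  let := TopCat.Presheaf.algebra_section_stalk X.presheaf (⟨x, hx⟩ : U)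
  let e := IsLocalization.algEquiv P.primeCompl (Localization.AtPrime P) (X.presheaf.stalk x)
  exact .of_ringEquiv e.toRingEquiv

theorem coheight_le_one_of_isDedekindDomain {U : X.Opens} (hU : IsAffineOpen U)
    (hD : IsDedekindDomain Γ(X, U)) {x : X} (hx : x ∈ U) : Order.coheight x ≤ 1 := by
  have := hU.isLocalization_stalk ⟨x, hx⟩
  let P := (hU.primeIdealOf ⟨x, hx⟩).asIdeal
  let := TopCat.Presheaf.algebra_section_stalk X.presheaf (⟨x, hx⟩ : U)
  have h1 := ringKrullDim_stalk_eq_coheight x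
  rw [IsLocalization.AtPrime.ringKrullDim_eq_height P (X.presheaf.stalk x)] at h1
  have h2 : Ring.KrullDimLE 1 Γ(X, U) := inferInstance
  have h3 : (P.height : WithBot ℕ∞) ≤ 1 :=
    (Ideal.height_le_ringKrullDim_of_ne_top (Ideal.IsPrime.ne_top')).trans
      ((Ring.krullDimLE_iff).mp h2)
  rw [h1] at h3
  exact_mod_cast h3

/-- A proper specialization of `x` would start a chain of length two ending at the generic point. -/
theorem isClosed_singleton_of_coheight_le_one [IsIntegral X]
    (h : ∀ x : X, Order.coheight x ≤ 1) {x : X} (hx : x ≠ genericPoint X) :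
    IsClosed ({x} : Set X) := by
  rw [← closure_subset_iff_isClosed]
  intro y hy
  have hxy : x ⤳ y := specializes_iff_mem_closure.mpr hy
  by_contra hne
  have h1 : y < x := ⟨hxy, fun h => hne (Specializes.antisymm h hxy).eq⟩
  have h2 : x < genericPoint X := ⟨genericPoint_specializes x, fun h =>
    hx (Specializes.antisymm h (genericPoint_specializes x)).eq⟩
  have h3 := Order.coheight_add_one_le h1
  have h4 := Order.coheight_add_one_le h2
  have h5 : (2 : ℕ∞) ≤ Order.coheight y := by
    refine le_trans ?_ h3
    have : (1 : ℕ∞) ≤ Order.coheight x := le_trans (by simp) h4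
    calc (2 : ℕ∞) = 1 + 1 := by norm_num
      _ ≤ _ := by gcongr
  have := h5.trans (h y)
  norm_num at this

/-- A proper closed subset of a Noetherian integral scheme of dimension one is finite. -/
theorem finite_of_isClosed [IsIntegral X] [TopologicalSpace.NoetherianSpace X]
    (h : ∀ x : X, Order.coheight x ≤ 1) {Z : Set X} (hZ : IsClosed Z)
    (hg : genericPoint X ∉ Z) : Z.Finite := by
  obtain ⟨S, hSfin, hScl, hSirr, rfl⟩ :=
    TopologicalSpace.NoetherianSpace.exists_finite_set_isClosed_irreducible hZ
  refine hSfin.sUnion fun t ht => ?_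
  obtain ⟨z, hz⟩ := QuasiSober.sober (hSirr t ht) (hScl t ht)
  have hzt : z ∈ t := hz.mem
  have hne : z ≠ genericPoint X := fun h => hg (h ▸ Set.mem_sUnion_of_mem hzt ht)
  rw [← hz.def, (isClosed_singleton_of_coheight_le_one h hne).closure_eq]
  exact Set.finite_singleton z

theorem isFinite_of_isProper_of_finite {Y : Scheme.{u}} (f : X ⟶ Y) [IsProper f]
    (hf : ∀ y, (f ⁻¹' {y}).Finite) : IsFinite f :=
  have := LocallyQuasiFinite.of_finite_preimage_singleton f hf
  .of_isProper_of_locallyQuasiFinite f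

end Scheme

/-! ### Properness of curves and finiteness of nonconstant morphisms. -/

section Curves

variable {K : Type u} [Field K]

instance (n : ℕ) : IsProper (projSpace K n).hom := by
  let 𝒜 := MvPolynomial.homogeneousSubmodule (Fin (n + 1)) K
  -- Polynomials of degree zero are constants, so passing from Spec of the degree-zero part to Spec
  -- K is a closed immersion.
  have hsurj : Function.Surjective (algebraMap K (𝒜 0)) := by
    rintro ⟨p, hp⟩
    have hp' := MvPolynomial.totalDegree_eq_zero_iff_eq_C.mp
      (Nat.le_zero.mp (MvPolynomial.IsHomogeneous.totalDegree_le hp))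
    exact ⟨_, Subtype.ext hp'.symm⟩
  have : Algebra.FiniteType (𝒜 0) (MvPolynomial (Fin (n + 1)) K) := by
    have h : ((algebraMap (𝒜 0) (MvPolynomial (Fin (n + 1)) K)).comp
        (algebraMap K (𝒜 0))).FiniteType :=
      (RingHom.finiteType_algebraMap (A := K) (B := MvPolynomial (Fin (n + 1)) K)).mpr inferInstance
    exact RingHom.finiteType_algebraMap.mp h.of_comp_finiteType
  have : IsClosedImmersion (Spec.map (CommRingCat.ofHom (algebraMap K (𝒜 0)))) :=
    IsClosedImmersion.spec_of_surjective _ hsurj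
  change IsProper (Proj.toSpecZero 𝒜 ≫ Spec.map (CommRingCat.ofHom (algebraMap K (𝒜 0))))
  infer_instance

variable {C D : Over (Spec (CommRingCat.of K))} [hC : IsCurve C] [hD : IsCurve D]

instance : IsProper C.hom := by
  obtain ⟨n, i, hi⟩ := hC.projective
  rw [← Over.w i]
  infer_instance

instance : IsLocallyNoetherian C.left := LocallyOfFiniteType.isLocallyNoetherian C.hom

instance : CompactSpace C.left :=
  isCompact_univ_iff.mp
    (QuasiCompact.isCompact_preimage (f := C.hom) Set.univ isOpen_univ isCompact_univ)

instance : IsNoetherian C.left where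

omit hC in
variable (C) in
theorem IsCurve.coheight_le_one [hC : IsCurve C] (x : C.left) : Order.coheight x ≤ 1 :=
  coheight_le_one_of_topologicalKrullDim_le_one hC.dim_eq_one.le x

instance (x : C.left) : IsPrincipalIdealRing (C.left.presheaf.stalk x) :=
  have := hC.nonsingular x
  isPrincipalIdealRing_of_isRegularLocalRing (by
    rw [ringKrullDim_stalk_eq_coheight]
    exact_mod_cast IsCurve.coheight_le_one C x)

/-- The morphism is proper, so finite fibres suffice. Over a closed point the fibre is a closed set
missing the generic point. A closed point over the generic point of `D` would make that point
closed, hence all of `D`. -/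
theorem IsNonconstant.isFinite {f : C ⟶ D} (hf : IsNonconstant f) : IsFinite f.left := by
  have : IsProper (f.left ≫ D.hom) := by rw [Over.w]; infer_instance
  have : IsProper f.left := .of_comp _ D.hom
  refine isFinite_of_isProper_of_finite _ fun y => ?_
  by_cases hy : y = genericPoint D.left
  · refine (Set.finite_singleton (genericPoint C.left)).subset fun x hx => ?_
    by_contra hne
    have hcl : IsClosed (f.left '' {x}) := f.left.isClosedMap _
      (isClosed_singleton_of_coheight_le_one (IsCurve.coheight_le_one C) hne)
    rw [Set.image_singleton, show f.left x = y from hx, hy] at hcl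
    refine hf ⟨genericPoint D.left, fun z => ?_⟩
    have : f.left z ∈ closure {genericPoint D.left} := by
      rw [genericPoint_closure]
      trivial
    rwa [hcl.closure_eq] at this
  · have hcl := isClosed_singleton_of_coheight_le_one (IsCurve.coheight_le_one D) hy
    refine finite_of_isClosed (IsCurve.coheight_le_one C) (hcl.preimage f.left.continuous) ?_
    intro h
    exact hy (hf.map_genericPoint.symm.trans h).symm

/-! ### Function fields -/

/-- The inclusion of the generic point of an integral scheme. -/
abbrev fromGeneric (X : Scheme.{u}) [IsIntegral X] : Spec X.functionField ⟶ X :=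
  X.fromSpecStalk (genericPoint X)

instance (X : Scheme.{u}) [IsIntegral X] : IsDominant (fromGeneric X) := by
  refine ⟨Dense.mono (s₁ := {genericPoint X}) ?_ (dense_iff_closure_eq.mpr (genericPoint_closure X))⟩
  rw [Scheme.range_fromSpecStalk, Set.singleton_subset_iff]
  exact specializes_rfl

theorem Spec_map_functionFieldMap (f : C ⟶ D) (hf : IsNonconstant f) :
    Spec.map (CommRingCat.ofHom (functionFieldMap f hf)) ≫ fromGeneric D.left =
      fromGeneric C.left ≫ f.left := by
  rw [functionFieldMap, CommRingCat.ofHom_hom, Spec.map_comp, Category.assoc,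
    Scheme.SpecMap_stalkSpecializes_fromSpecStalk, Scheme.SpecMap_stalkMap_fromSpecStalk]

/-- The inclusion of the generic point is a monomorphism, so a map of function fields is determined
by its square with the morphism. -/
theorem functionFieldMap_eq_of_comp_eq (f : C ⟶ D) (hf : IsNonconstant f)
    (θ : D.left.functionField →+* C.left.functionField)
    (h : Spec.map (CommRingCat.ofHom θ) ≫ fromGeneric D.left = fromGeneric C.left ≫ f.left) :
    functionFieldMap f hf = θ := by
  rw [← Spec_map_functionFieldMap f hf, cancel_mono] at h
  have := Spec.map_injective h
  exact congrArg CommRingCat.Hom.hom this.symm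

theorem functionFieldMap_comp {E : Over (Spec (CommRingCat.of K))} [IsCurve E] (f : C ⟶ D)
    (g : D ⟶ E) (hf : IsNonconstant f) (hg : IsNonconstant g) (hfg : IsNonconstant (f ≫ g)) :
    functionFieldMap (f ≫ g) hfg = (functionFieldMap f hf).comp (functionFieldMap g hg) := by
  apply functionFieldMap_eq_of_comp_eq
  rw [CommRingCat.ofHom_comp, Spec.map_comp, Category.assoc, Spec_map_functionFieldMap,
    ← Category.assoc, Spec_map_functionFieldMap, Category.assoc, Over.comp_left]

end Curves

/-! ### Points with values in a field -/

section Eval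

variable {E : Type u} [Field E] {X Y T : Scheme.{u}}

/-- The evaluation of sections at a point with values in a field. -/
def evalAt (s : Spec (CommRingCat.of E) ⟶ X) (U : X.Opens) (h : ⊤ ≤ s ⁻¹ᵁ U) : Γ(X, U) →+* E :=
  (s.appLE U ⊤ h ≫ (Scheme.ΓSpecIso (CommRingCat.of E)).hom).hom

theorem evalAt_comp (s : Spec (CommRingCat.of E) ⟶ X) (f : X ⟶ Y) (U : Y.Opens)
    (h : ⊤ ≤ s ⁻¹ᵁ (f ⁻¹ᵁ U)) (h' : ⊤ ≤ (s ≫ f) ⁻¹ᵁ U) (a : Γ(Y, U)) :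
    evalAt s (f ⁻¹ᵁ U) h (f.app U a) = evalAt (s ≫ f) U h' a := by
  rw [evalAt, evalAt, Scheme.Hom.comp_appLE, Category.assoc]
  rfl

theorem evalAt_Spec_map_fromGeneric [IsIntegral X] (σ : X.functionField →+* E) (U : X.Opens)
    [Nonempty U] (h : ⊤ ≤ (Spec.map (CommRingCat.ofHom σ) ≫ fromGeneric X) ⁻¹ᵁ U) (a : Γ(X, U)) :
    evalAt (Spec.map (CommRingCat.ofHom σ) ≫ fromGeneric X) U h a =
      σ (X.germToFunctionField U a) := by
  have hU : genericPoint X ∈ U :=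
    ((genericPoint_spec X).mem_open_set_iff U.isOpen).mpr (by simpa using ‹Nonempty U›)
  have : (Spec.map (CommRingCat.ofHom σ) ≫ fromGeneric X).appLE U ⊤ h ≫
      (Scheme.ΓSpecIso (CommRingCat.of E)).hom =
      X.germToFunctionField U ≫ CommRingCat.ofHom σ := by
    have h0 : ⊤ ≤ Spec.map (CommRingCat.ofHom σ) ⁻¹ᵁ (fromGeneric X ⁻¹ᵁ U) := h
    have h1 : (Spec.map (CommRingCat.ofHom σ)).appLE ⊤ ⊤ le_top =
        (Spec.map (CommRingCat.ofHom σ)).appTop := Scheme.Hom.appLE_eq_app _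
    calc _ = ((fromGeneric X).app U ≫ (Spec.map (CommRingCat.ofHom σ)).appLE _ ⊤ h0) ≫
          (Scheme.ΓSpecIso (CommRingCat.of E)).hom := by rw [Scheme.Hom.comp_appLE]
      _ = X.germToFunctionField U ≫ (Scheme.ΓSpecIso X.functionField).inv ≫
          (Spec.map (CommRingCat.ofHom σ)).appLE ⊤ ⊤ le_top ≫
          (Scheme.ΓSpecIso (CommRingCat.of E)).hom := by
        rw [Scheme.fromSpecStalk_app hU, Category.assoc, Category.assoc, Category.assoc,
          Scheme.Hom.map_appLE_assoc]
      _ = _ := by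
        rw [h1]
        have := Scheme.ΓSpecIso_inv_naturality (R := X.functionField) (S := CommRingCat.of E)
          (CommRingCat.ofHom σ)
        refine congrArg (X.germToFunctionField U ≫ ·) ?_
        exact ((Iso.comp_inv_eq _).mp (this.trans rfl)).symm
  rw [evalAt, this]
  rfl

theorem evalAt_fromGeneric [IsIntegral X] (U : X.Opens) [Nonempty U] (h : ⊤ ≤ fromGeneric X ⁻¹ᵁ U)
    (a : Γ(X, U)) :
    evalAt (E := X.functionField) (fromGeneric X) U h a = X.germToFunctionField U a := by
  have h1 : Spec.map (CommRingCat.ofHom (RingHom.id X.functionField)) ≫ fromGeneric X =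
      fromGeneric X := by
    rw [CommRingCat.ofHom_id]
    exact (congrArg (· ≫ fromGeneric X) (Spec.map_id X.functionField)).trans (Category.id_comp _)
  have := evalAt_Spec_map_fromGeneric (RingHom.id X.functionField) U (h1.symm ▸ h) a
  simp only [h1] at this
  exact this

theorem top_le_preimage_of_nonempty [IsIntegral X] (s : Spec (CommRingCat.of E) ⟶ X) [IsDominant s]
    (U : X.Opens) [hU : Nonempty U] : ⊤ ≤ s ⁻¹ᵁ U := by
  intro x _
  obtain ⟨y, hy⟩ := s.denseRange.exists_mem_open U.isOpen (Set.nonempty_coe_sort.mp hU)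
  rwa [Subsingleton.elim x y]

/-- A dominant point with values in a field factors through the generic point. -/
theorem exists_Spec_map_fromGeneric_eq [IsIntegral X] (s : Spec (CommRingCat.of E) ⟶ X)
    [IsDominant s] : ∃ σ : X.functionField →+* E,
      Spec.map (CommRingCat.ofHom σ) ≫ fromGeneric X = s := by
  have hs : s (IsLocalRing.closedPoint E) = genericPoint X := by
    have h : Set.range s = {s (IsLocalRing.closedPoint E)} :=
      Set.eq_singleton_iff_unique_mem.mpr ⟨⟨_, rfl⟩, by
        rintro _ ⟨y, rfl⟩
        exact congrArg s (Subsingleton.elim _ _)⟩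
    have h' : s (IsLocalRing.closedPoint E) ⤳ genericPoint X := by
      rw [specializes_iff_mem_closure, ← h, s.denseRange.closure_range]
      trivial
    exact (h'.antisymm (genericPoint_specializes _)).eq
  refine ⟨(X.presheaf.stalkSpecializes (specializes_of_eq hs) ≫
    Scheme.stalkClosedPointTo s).hom, ?_⟩
  rw [CommRingCat.ofHom_hom, Spec.map_comp, Category.assoc,
    Scheme.SpecMap_stalkSpecializes_fromSpecStalk, Scheme.Spec_stalkClosedPointTo_fromSpecStalk]

/-- The sections of the normalization in a field are the integral elements of the field. -/
theorem evalAt_toNormalization (s : Spec (CommRingCat.of E) ⟶ Y) [QuasiCompact s]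
    [QuasiSeparated s] {U : Y.Opens} (hU : IsAffineOpen U) (h : ⊤ ≤ s ⁻¹ᵁ U)
    (h' : ⊤ ≤ s.toNormalization ⁻¹ᵁ (s.fromNormalization ⁻¹ᵁ U)) :
    Function.Injective (evalAt s.toNormalization (s.fromNormalization ⁻¹ᵁ U) h') ∧
      ∀ x, x ∈ (evalAt s.toNormalization (s.fromNormalization ⁻¹ᵁ U) h').range ↔
        (evalAt s U h).IsIntegralElem x := by
  let := (s.app U).hom.toAlgebra
  let ρ := (Spec (CommRingCat.of E)).presheaf.map (homOfLE h).op ≫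
    (Scheme.ΓSpecIso (CommRingCat.of E)).hom
  have hρ : IsIso ρ := by
    have : IsIso (homOfLE h) := by
      have := top_le_iff.mp h
      exact ⟨homOfLE le_top, Subsingleton.elim _ _, Subsingleton.elim _ _⟩
    infer_instance
  let r := CommRingCat.Hom.hom ρ
  have hr : Function.Bijective r := ConcreteCategory.bijective_of_isIso ρ
  have h1 : evalAt s U h = r.comp (s.app U).hom := by
    rw [evalAt, Scheme.Hom.appLE, Category.assoc]
    rfl
  have h2 : ∀ b, evalAt s.toNormalization (s.fromNormalization ⁻¹ᵁ U) h' b =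
      r ((s.normalizationObjIso hU).hom b).1 := by
    intro b
    have := s.normalizationObjIso_hom_val hU
    have h3 : s.toNormalization.appLE (s.fromNormalization ⁻¹ᵁ U) ⊤ h' =
      ((s.normalizationObjIso hU).hom ≫ CommRingCat.ofHom (Subalgebra.val _).toRingHom) ≫
        (Spec (CommRingCat.of E)).presheaf.map (homOfLE h).op := by
      rw [this, Scheme.Hom.appLE_map]
    rw [evalAt, h3]
    rfl
  have hbij : Function.Bijective (s.normalizationObjIso hU).hom :=
    ConcreteCategory.bijective_of_isIso _
  refine ⟨fun b c hbc => ?_, fun x => ⟨?_, ?_⟩⟩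
  · rw [h2, h2] at hbc
    exact hbij.1 (Subtype.ext (hr.1 hbc))
  · rintro ⟨b, rfl⟩
    rw [h1, h2]
    obtain ⟨p, hp, hp'⟩ := ((s.normalizationObjIso hU).hom b).2
    refine ⟨p, hp, ?_⟩
    rw [← Polynomial.hom_eval₂]
    exact (congrArg r hp').trans (map_zero r)
  · intro hx
    obtain ⟨y, rfl⟩ := hr.2 x
    obtain ⟨p, hp, hp'⟩ := hx
    rw [h1, ← Polynomial.hom_eval₂] at hp'
    have hy : IsIntegral Γ(Y, U) y := ⟨p, hp, hr.1 (hp'.trans (map_zero r).symm)⟩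
    obtain ⟨b, hb⟩ := hbij.2 ⟨y, hy⟩
    exact ⟨b, by rw [h2, hb]⟩

end Eval

/-! ### Extension of morphisms from normal schemes -/

section Lift

variable {X T Y : Scheme.{u}} [IsIntegral X]

/-- A normal scheme is its own normalization in its function field: integral closedness makes the
map surjective on sections, hence a closed immersion, and it is dominant onto a reduced scheme. -/
theorem isIso_fromNormalization_fromGeneric
    (hX : ∀ U : X.Opens, IsAffineOpen U → Nonempty U → IsIntegrallyClosed Γ(X, U)) :
    IsIso (fromGeneric X).fromNormalization := by
  have : IsClosedImmersion (fromGeneric X).fromNormalization := by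
    refine isClosedImmersion_iff_isAffineHom.mpr ⟨inferInstance, fun U hU b => ?_⟩
    rcases isEmpty_or_nonempty U with hemp | hne
    · have : U = ⊥ := by
        ext x
        exact ⟨fun hx => (hemp.false ⟨x, hx⟩).elim, fun hx => hx.elim⟩
      subst this
      refine ⟨0, ?_⟩
      have : Subsingleton Γ((fromGeneric X).normalization,
          (fromGeneric X).fromNormalization ⁻¹ᵁ ⊥) := by
        rw [Scheme.Hom.preimage_bot]
        infer_instance
      exact Subsingleton.elim _ _
    · have := hX U hU hne
      have := functionField_isFractionRing_of_isAffineOpen X U hU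
      have h := top_le_preimage_of_nonempty (E := X.functionField) (fromGeneric X) U
      have h' : ⊤ ≤ (fromGeneric X).toNormalization ⁻¹ᵁ
          ((fromGeneric X).fromNormalization ⁻¹ᵁ U) := by
        rwa [← Scheme.Hom.comp_preimage, Scheme.Hom.toNormalization_fromNormalization]
      obtain ⟨hinj, hmem⟩ :=
        evalAt_toNormalization (E := X.functionField) (fromGeneric X) hU h h'
      have hev : evalAt (E := X.functionField) (fromGeneric X) U h =
          algebraMap Γ(X, U) X.functionField := RingHom.ext (evalAt_fromGeneric U h)
      have hb := (hmem _).mp ⟨b, rfl⟩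
      rw [hev] at hb
      obtain ⟨a, ha⟩ := IsIntegrallyClosed.isIntegral_iff.mp hb
      refine ⟨a, hinj ?_⟩
      rw [← ha]
      refine (evalAt_comp _ _ _ _ (by rwa [Scheme.Hom.toNormalization_fromNormalization]) a).trans ?_
      simp only [Scheme.Hom.toNormalization_fromNormalization]
      exact evalAt_fromGeneric U h a
  have : IsDominant (fromGeneric X).fromNormalization := by
    have : IsDominant ((fromGeneric X).toNormalization ≫ (fromGeneric X).fromNormalization) := by
      rw [Scheme.Hom.toNormalization_fromNormalization]
      infer_instance
    exact .of_comp (fromGeneric X).toNormalization _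
  have : Surjective (fromGeneric X).fromNormalization :=
    surjective_of_isDominant_of_isClosed_range _
      (fromGeneric X).fromNormalization.isClosedMap.isClosed_range
  exact isIso_of_isClosedImmersion_of_surjective _

/-- The generic lift gives a generic section of the integral morphism X ×_Y T → X. The universal
property of normalization extends it over all of `X`. -/
theorem exists_lift_of_isIntegralHom
    (hX : ∀ U : X.Opens, IsAffineOpen U → Nonempty U → IsIntegrallyClosed Γ(X, U))
    (p : T ⟶ Y) [IsIntegralHom p] (f : X ⟶ Y) (s : Spec X.functionField ⟶ T)
    (hs : s ≫ p = fromGeneric X ≫ f) : ∃ t : X ⟶ T, t ≫ p = f ∧ fromGeneric X ≫ t = s := by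
  have := isIso_fromNormalization_fromGeneric hX
  let d := (fromGeneric X).normalizationDesc
    (Limits.pullback.lift (fromGeneric X) s hs.symm) (Limits.pullback.fst f p)
    (Limits.pullback.lift_fst _ _ _).symm
  have hd : d ≫ Limits.pullback.fst f p = (fromGeneric X).fromNormalization :=
    Scheme.Hom.normalizationDesc_comp _ _ _ _
  refine ⟨inv (fromGeneric X).fromNormalization ≫ d ≫ Limits.pullback.snd f p, ?_, ?_⟩
  · rw [Category.assoc, Category.assoc, ← Limits.pullback.condition, reassoc_of% hd,
      IsIso.inv_hom_id_assoc]
  · have h : fromGeneric X ≫ inv (fromGeneric X).fromNormalization =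
        (fromGeneric X).toNormalization := by
      rw [IsIso.comp_inv_eq, Scheme.Hom.toNormalization_fromNormalization]
    rw [reassoc_of% h, Scheme.Hom.toNormalization_normalizationDesc_assoc, Limits.pullback.lift_snd]

end Lift

/-! ### Normalization in a finite separable extension of the function field -/

section Normalization

variable (Y : Scheme.{u}) [IsIntegral Y] (E : Type u) [Field E] [Algebra Y.functionField E]

/-- The point of `Y` with values in an extension of its function field. -/
def genericPointMap : Spec (CommRingCat.of E) ⟶ Y :=
  Spec.map (CommRingCat.ofHom (algebraMap Y.functionField E)) ≫ fromGeneric Y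

instance : IsDominant (genericPointMap Y E) := by
  have : Surjective (Spec.map (CommRingCat.ofHom (algebraMap Y.functionField E))) := by
    refine ⟨fun x => ⟨IsLocalRing.closedPoint E, ?_⟩⟩
    exact Subsingleton.elim (α := PrimeSpectrum Y.functionField) _ _
  unfold genericPointMap
  infer_instance

instance : QuasiCompact (genericPointMap Y E) := inferInstance
instance : QuasiSeparated (genericPointMap Y E) := inferInstance

/-- The normalization of `Y` in an extension of its function field. -/
abbrev normalizationIn : Scheme.{u} := (genericPointMap Y E).normalization

/-- The structure map of the normalization. -/
abbrev normalizationInMap : normalizationIn Y E ⟶ Y := (genericPointMap Y E).fromNormalization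

instance : IsIntegral (normalizationIn Y E) := inferInstance

variable {Y}

theorem nonempty_preimage_normalizationInMap (U : Y.Opens) [Nonempty U] :
    Nonempty (normalizationInMap Y E ⁻¹ᵁ U) := by
  obtain ⟨x⟩ : Nonempty (Spec (CommRingCat.of E)) := inferInstance
  refine ⟨⟨(genericPointMap Y E).toNormalization x, ?_⟩⟩
  have h := top_le_preimage_of_nonempty (genericPointMap Y E) U (x := x) trivial
  rwa [← (genericPointMap Y E).toNormalization_fromNormalization] at h

theorem top_le_preimage_normalizationInMap (U : Y.Opens) [Nonempty U] :
    ⊤ ≤ (genericPointMap Y E).toNormalization ⁻¹ᵁ (normalizationInMap Y E ⁻¹ᵁ U) := by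
  rw [← Scheme.Hom.comp_preimage, Scheme.Hom.toNormalization_fromNormalization]
  exact top_le_preimage_of_nonempty _ U

theorem evalAt_normalizationInMap_app (U : Y.Opens) [Nonempty U] (a : Γ(Y, U)) :
    evalAt (genericPointMap Y E).toNormalization (normalizationInMap Y E ⁻¹ᵁ U)
      (top_le_preimage_normalizationInMap E U) ((normalizationInMap Y E).app U a) =
      algebraMap Y.functionField E (Y.germToFunctionField U a) := by
  have h : ⊤ ≤ ((genericPointMap Y E).toNormalization ≫ normalizationInMap Y E) ⁻¹ᵁ U := by
    rw [Scheme.Hom.toNormalization_fromNormalization]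
    exact top_le_preimage_of_nonempty _ U
  rw [evalAt_comp _ _ _ _ h]
  simp only [Scheme.Hom.toNormalization_fromNormalization]
  exact evalAt_Spec_map_fromGeneric _ _ _ _

/-- Over a normal Noetherian affine open, the normalization in a finite separable extension is
finite and given by a Dedekind domain. -/
theorem isDedekindDomain_normalizationIn [FiniteDimensional Y.functionField E]
    [Algebra.IsSeparable Y.functionField E] {U : Y.Opens} (hU : IsAffineOpen U) [Nonempty U]
    [IsDedekindDomain Γ(Y, U)] :
    IsDedekindDomain Γ(normalizationIn Y E, normalizationInMap Y E ⁻¹ᵁ U) ∧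
      ((normalizationInMap Y E).app U).hom.Finite := by
  have := functionField_isFractionRing_of_isAffineOpen Y U hU
  have := nonempty_preimage_normalizationInMap E U
  let e := evalAt (genericPointMap Y E).toNormalization (normalizationInMap Y E ⁻¹ᵁ U)
    (top_le_preimage_normalizationInMap E U)
  let a₁ : Algebra Γ(Y, U) E :=
    ((algebraMap Y.functionField E).comp (algebraMap Γ(Y, U) Y.functionField)).toAlgebra
  let a₂ : Algebra Γ(normalizationIn Y E, normalizationInMap Y E ⁻¹ᵁ U) E := e.toAlgebra
  let a₃ : Algebra Γ(Y, U) Γ(normalizationIn Y E, normalizationInMap Y E ⁻¹ᵁ U) :=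
    ((normalizationInMap Y E).app U).hom.toAlgebra
  have : IsScalarTower Γ(Y, U) Y.functionField E := .of_algebraMap_eq' rfl
  have : IsScalarTower Γ(Y, U) Γ(normalizationIn Y E, normalizationInMap Y E ⁻¹ᵁ U) E :=
    .of_algebraMap_eq fun a => (evalAt_normalizationInMap_app E U a).symm
  obtain ⟨hinj, hmem⟩ := evalAt_toNormalization (genericPointMap Y E) hU
    (top_le_preimage_of_nonempty _ U) (top_le_preimage_normalizationInMap E U)
  have hev : evalAt (genericPointMap Y E) U (top_le_preimage_of_nonempty _ U) =
      algebraMap Γ(Y, U) E := RingHom.ext fun a => evalAt_Spec_map_fromGeneric _ _ _ _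
  have : IsIntegralClosure Γ(normalizationIn Y E, normalizationInMap Y E ⁻¹ᵁ U) Γ(Y, U) E := by
    refine ⟨hinj, fun {x} => ?_⟩
    rw [show _root_.IsIntegral Γ(Y, U) x ↔ (algebraMap Γ(Y, U) E).IsIntegralElem x from Iff.rfl,
      ← hev, ← hmem]
    rfl
  exact ⟨IsIntegralClosure.isDedekindDomain Γ(Y, U) Y.functionField E _,
    IsIntegralClosure.finite Γ(Y, U) Y.functionField E _⟩

theorem isFinite_normalizationInMap [FiniteDimensional Y.functionField E]
    [Algebra.IsSeparable Y.functionField E]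
    (hY : ∀ U : Y.Opens, IsAffineOpen U → Nonempty U → IsDedekindDomain Γ(Y, U)) :
    IsFinite (normalizationInMap Y E) := by
  refine (isFinite_iff _).mpr ⟨inferInstance, fun U hU => ?_⟩
  rcases isEmpty_or_nonempty U with hemp | hne
  · have : U = ⊥ := by
      ext x
      exact ⟨fun hx => (hemp.false ⟨x, hx⟩).elim, fun hx => hx.elim⟩
    subst this
    have : Subsingleton Γ(normalizationIn Y E, normalizationInMap Y E ⁻¹ᵁ ⊥) := by
      rw [Scheme.Hom.preimage_bot]
      infer_instance
    exact .of_surjective _ fun b => ⟨0, Subsingleton.elim _ _⟩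
  · have := hY U hU hne
    exact (isDedekindDomain_normalizationIn E hU).2

/-- The function field of the normalization. -/
theorem exists_functionField_normalizationIn [Algebra.IsAlgebraic Y.functionField E] :
    ∃ σ : (normalizationIn Y E).functionField →+* E, Function.Bijective σ ∧
      Spec.map (CommRingCat.ofHom σ) ≫ fromGeneric (normalizationIn Y E) =
        (genericPointMap Y E).toNormalization := by
  obtain ⟨σ, hσ⟩ := exists_Spec_map_fromGeneric_eq (genericPointMap Y E).toNormalization
  refine ⟨σ, ⟨σ.injective, fun x => ?_⟩, hσ⟩
  obtain ⟨_, ⟨U, hU, rfl⟩, hxU, -⟩ :=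
    Y.isBasis_affineOpens.exists_subset_of_mem_open (Set.mem_univ (genericPoint Y)) isOpen_univ
  have hne : Nonempty U := ⟨⟨_, hxU⟩⟩
  have := functionField_isFractionRing_of_isAffineOpen Y U hU
  have := nonempty_preimage_normalizationInMap E U
  let a₁ : Algebra Γ(Y, U) E :=
    ((algebraMap Y.functionField E).comp (algebraMap Γ(Y, U) Y.functionField)).toAlgebra
  have : IsScalarTower Γ(Y, U) Y.functionField E := .of_algebraMap_eq' rfl
  have hx : IsAlgebraic Γ(Y, U) x :=
    (IsFractionRing.isAlgebraic_iff Γ(Y, U) Y.functionField E).mpr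
      (Algebra.IsAlgebraic.isAlgebraic x)
  -- Thus x is a quotient of elements integral over Γ(Y, U). Those come from sections of the
  -- normalization, and the image of σ is a field.
  obtain ⟨y, hy, hxy⟩ := hx.exists_integral_multiple
  obtain ⟨hinj, hmem⟩ := evalAt_toNormalization (genericPointMap Y E) hU
    (top_le_preimage_of_nonempty _ U) (top_le_preimage_normalizationInMap E U)
  have hev : evalAt (genericPointMap Y E) U (top_le_preimage_of_nonempty _ U) =
      algebraMap Γ(Y, U) E := RingHom.ext fun a => evalAt_Spec_map_fromGeneric _ _ _ _
  have hev' : ∀ b, evalAt (genericPointMap Y E).toNormalization (normalizationInMap Y E ⁻¹ᵁ U)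
      (top_le_preimage_normalizationInMap E U) b =
        σ ((normalizationIn Y E).germToFunctionField (normalizationInMap Y E ⁻¹ᵁ U) b) := by
    intro b
    simp only [← hσ]
    exact evalAt_Spec_map_fromGeneric _ _ _ _
  have hrange : ∀ z : E, _root_.IsIntegral Γ(Y, U) z → z ∈ σ.range := by
    intro z hz
    replace hz : (algebraMap Γ(Y, U) E).IsIntegralElem z := hz
    rw [← hev, ← hmem] at hz
    obtain ⟨b, rfl⟩ := hz
    rw [hev']
    exact ⟨_, rfl⟩
  have h0 : algebraMap Γ(Y, U) E y ≠ 0 := by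
    rw [IsScalarTower.algebraMap_apply _ Y.functionField E, Ne, map_eq_zero]
    exact (map_ne_zero_iff _ (IsFractionRing.injective _ _)).mpr hy
  rw [Algebra.smul_def] at hxy
  have h1 := σ.fieldRange.div_mem (x := algebraMap Γ(Y, U) E y * x) (hrange _ hxy)
    (hrange (algebraMap Γ(Y, U) E y) isIntegral_algebraMap)
  rw [mul_div_cancel_left₀ _ h0] at h1
  exact h1

end Normalization

/-! ### Points of `Proj` with values in a ring -/

section ProjPoint

open HomogeneousLocalization

variable {σ : Type*} {A R S : Type u} [CommRing A] [CommRing R] [CommRing S] [SetLike σ A]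
  [AddSubgroupClass σ A] (𝒜 : ℕ → σ) [GradedRing 𝒜]

/-- The ring homomorphism on homogeneous fractions induced by a ring homomorphism that makes the
denominator invertible. -/
def liftAway (f : A →+* R) {t : A} (ht : IsUnit (f t)) : Away 𝒜 t →+* R :=
  (IsLocalization.Away.lift (S := Localization.Away t) t ht).comp (algebraMap (Away 𝒜 t) _)

variable {𝒜}

theorem liftAway_mk (f : A →+* R) {t : A} (ht : IsUnit (f t)) {d : ℕ} (hd : t ∈ 𝒜 d) (n : ℕ)
    (a : A) (ha : a ∈ 𝒜 (n • d)) : liftAway 𝒜 f ht (Away.mk 𝒜 hd n a ha) * f t ^ n = f a := by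
  have h : algebraMap (Away 𝒜 t) (Localization.Away t) (Away.mk 𝒜 hd n a ha) *
      algebraMap A _ t ^ n = algebraMap A _ a := by
    rw [HomogeneousLocalization.algebraMap_apply, Away.val_mk, ← map_pow,
      Localization.mk_eq_mk', mul_comm]
    exact IsLocalization.mk'_spec' (S := Localization.Away t) a
      (⟨t ^ n, n, rfl⟩ : Submonoid.powers t)
  have := congrArg (IsLocalization.Away.lift (S := Localization.Away t) t ht) h
  simpa [liftAway] using this

theorem liftAway_comp_fromZeroRingHom (f : A →+* R) {t : A} (ht : IsUnit (f t)) (a : 𝒜 0) :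
    liftAway 𝒜 f ht (fromZeroRingHom 𝒜 _ a) = f a := by
  have h : algebraMap (Away 𝒜 t) (Localization.Away t) (fromZeroRingHom 𝒜 _ a) =
      algebraMap A _ a := rfl
  rw [liftAway, RingHom.comp_apply, h, IsLocalization.Away.lift_eq]

theorem comp_liftAway (f : A →+* R) (φ : R →+* S) {t : A} (ht : IsUnit (f t))
    (ht' : IsUnit (φ.comp f t)) : φ.comp (liftAway 𝒜 f ht) = liftAway 𝒜 (φ.comp f) ht' := by
  rw [liftAway, liftAway, ← RingHom.comp_assoc]
  congr 1
  refine IsLocalization.ringHom_ext (Submonoid.powers t) ?_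
  ext a
  simp

theorem liftAway_comp_awayMap (f : A →+* R) {s t x : A} (hx : x = t * s) (ht : IsUnit (f t))
    (hxu : IsUnit (f x)) {e : ℕ} (hs : s ∈ 𝒜 e) :
    (liftAway 𝒜 f hxu).comp (awayMap 𝒜 hs hx) = liftAway 𝒜 f ht := by
  have h : (algebraMap (Away 𝒜 x) (Localization.Away x)).comp (awayMap 𝒜 hs hx) =
      (IsLocalization.Away.lift (S := Localization.Away t) t (g := algebraMap A _)
        (isUnit_of_dvd_unit (Dvd.intro _ ((map_mul (algebraMap A (Localization.Away x)) t s).symm.trans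
          (congrArg _ hx.symm)))
          (IsLocalization.Away.algebraMap_isUnit x))).comp (algebraMap (Away 𝒜 t) _) := by
    ext a
    exact val_awayMap (𝒜 := 𝒜) hs hx a
  rw [liftAway, RingHom.comp_assoc, h, ← RingHom.comp_assoc, liftAway]
  congr 1
  refine IsLocalization.ringHom_ext (Submonoid.powers t) ?_
  ext a
  simp

/-- The point of `Proj` with values in `R` given by a ring homomorphism that makes a homogeneous
element of positive degree invertible. -/
def projPoint (f : A →+* R) {t : A} (ht : IsUnit (f t)) {d : ℕ} (hd : t ∈ 𝒜 d) (h0 : 0 < d) :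
    Spec (CommRingCat.of R) ⟶ Proj 𝒜 :=
  Spec.map (CommRingCat.ofHom (liftAway 𝒜 f ht)) ≫ Proj.awayι 𝒜 t hd h0

theorem Spec_map_projPoint (f : A →+* R) (φ : R →+* S) {t : A} (ht : IsUnit (f t)) {d : ℕ}
    (hd : t ∈ 𝒜 d) (h0 : 0 < d) (ht' : IsUnit (φ.comp f t)) :
    Spec.map (CommRingCat.ofHom φ) ≫ projPoint f ht hd h0 = projPoint (φ.comp f) ht' hd h0 := by
  rw [projPoint, projPoint, ← Category.assoc, ← Spec.map_comp, ← CommRingCat.ofHom_comp,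
    comp_liftAway f φ ht ht']

/-- Both points factor through the chart where s * t is invertible. -/
theorem projPoint_eq (f : A →+* R) {s t : A} (hs : IsUnit (f s)) (ht : IsUnit (f t)) {d e : ℕ}
    (hd : s ∈ 𝒜 d) (h0 : 0 < d) (he : t ∈ 𝒜 e) (h0' : 0 < e) :
    projPoint f hs hd h0 = projPoint f ht he h0' := by
  have hst : IsUnit (f (s * t)) := by rw [map_mul]; exact hs.mul ht
  rw [projPoint, projPoint, ← liftAway_comp_awayMap f rfl hs hst he,
    ← liftAway_comp_awayMap f (mul_comm s t) ht hst hd, CommRingCat.ofHom_comp,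
    CommRingCat.ofHom_comp, Spec.map_comp, Spec.map_comp, Category.assoc, Category.assoc,
    Proj.SpecMap_awayMap_awayι, Proj.SpecMap_awayMap_awayι]
  rfl

/-- Rescaling homogeneous coordinates by a factor `u` does not change the point. -/
theorem liftAway_eq_of_smul {f g : A →+* R} (u : R) {t : A} {d : ℕ} (hd : t ∈ 𝒜 d)
    (hf : IsUnit (f t)) (hg : IsUnit (g t)) (h : ∀ n, ∀ a ∈ 𝒜 n, g a = u ^ n * f a) :
    liftAway 𝒜 f hf = liftAway 𝒜 g hg := by
  ext z
  obtain ⟨n, a, ha, rfl⟩ := Away.mk_surjective 𝒜 hd z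
  refine ((hg.pow n).mul_left_inj).mp ?_
  rw [liftAway_mk, h _ _ ha, h _ _ hd, mul_pow, ← pow_mul, mul_left_comm, liftAway_mk,
    smul_eq_mul, mul_comm d n]

/-- The preimage of a standard open set under a point of `Proj`. -/
theorem projPoint_preimage_basicOpen (f : A →+* R) {s t : A} (ht : IsUnit (f t)) {d e : ℕ}
    (hd : t ∈ 𝒜 d) (h0 : 0 < d) (he : s ∈ 𝒜 e) (h0' : 0 < e) :
    projPoint f ht hd h0 ⁻¹ᵁ Proj.basicOpen 𝒜 s = PrimeSpectrum.basicOpen (f s) := by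
  rw [projPoint, Scheme.Hom.comp_preimage, Proj.awayι_preimage_basicOpen 𝒜 hd h0 he h0']
  have h := liftAway_mk f ht hd e (s ^ d) (by
    rw [smul_eq_mul, mul_comm]; exact SetLike.pow_mem_graded _ he)
  have h1 : liftAway 𝒜 f ht (Away.isLocalizationElem hd he) * f t ^ e = f s ^ d := by
    rw [← map_pow f s]; exact h
  change PrimeSpectrum.basicOpen (liftAway 𝒜 f ht (Away.isLocalizationElem hd he)) = _
  rw [← PrimeSpectrum.basicOpen_pow (f s) d h0, ← h1, PrimeSpectrum.basicOpen_mul,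
    eq_comm, inf_eq_left]
  exact fun x _ hx => x.2.ne_top (Ideal.eq_top_of_isUnit_mem _ hx (ht.pow e))

end ProjPoint

/-! ### Gluing morphisms from an integral scheme -/

section Glue

variable {X Y P W : Scheme.{u}}

theorem isDominant_of_comp_isOpenImmersion (t : W ⟶ X) (j : X ⟶ Y) [IsOpenImmersion j]
    [IsDominant (t ≫ j)] : IsDominant t := by
  refine ⟨dense_iff_inter_open.mpr fun V hV hne => ?_⟩
  obtain ⟨w, v, hv, hw⟩ := (t ≫ j).denseRange.exists_mem_open (j.isOpenEmbedding.isOpenMap V hV)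
    (hne.image j)
  rw [Scheme.Hom.comp_apply] at hw
  exact ⟨t w, j.isOpenEmbedding.injective hw ▸ hv, w, rfl⟩

/-- Compatibility on overlaps is automatic: `W` is dense in each overlap, overlaps are reduced and
`P` is separated. -/
theorem exists_glueMorphisms [IsReduced X] [P.IsSeparated] (𝒰 : X.OpenCover) (g : W ⟶ X)
    [IsDominant g] (t : ∀ i, W ⟶ 𝒰.X i) (ht : ∀ i, t i ≫ 𝒰.f i = g) (h : ∀ i, 𝒰.X i ⟶ P)
    (s : W ⟶ P) (hs : ∀ i, t i ≫ h i = s) : ∃ G : X ⟶ P, ∀ i, 𝒰.f i ≫ G = h i := by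
  refine ⟨𝒰.glueMorphisms h fun i j => ?_, 𝒰.ι_glueMorphisms h _⟩
  let τ := Limits.pullback.lift (t i) (t j) ((ht i).trans (ht j).symm)
  have : IsDominant (τ ≫ Limits.pullback.fst (𝒰.f i) (𝒰.f j) ≫ 𝒰.f i) := by
    rwa [Limits.pullback.lift_fst_assoc, ht]
  have := isDominant_of_comp_isOpenImmersion τ (Limits.pullback.fst (𝒰.f i) (𝒰.f j) ≫ 𝒰.f i)
  have : IsReduced (Limits.pullback (𝒰.f i) (𝒰.f j)) :=
    isReduced_of_isOpenImmersion (Limits.pullback.fst (𝒰.f i) (𝒰.f j) ≫ 𝒰.f i)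
  refine ext_of_isDominant τ ?_
  rw [Limits.pullback.lift_fst_assoc, Limits.pullback.lift_snd_assoc, hs, hs]

/-- By `hV`, points with the same image lie in a common chart, so injectivity is checked chartwise.
Injective and surjective on stalks give a monomorphism, and a proper monomorphism is a closed
immersion. -/
theorem isClosedImmersion_of_openCover (𝒰 : X.OpenCover) (G : X ⟶ P) [IsProper G]
    (h : ∀ i, IsPreimmersion (𝒰.f i ≫ G)) (V : 𝒰.I₀ → P.Opens)
    (hV : ∀ i, G ⁻¹ᵁ V i = (𝒰.f i).opensRange) : IsClosedImmersion G := by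
  have : SurjectiveOnStalks G :=
    (IsZariskiLocalAtSource.iff_of_openCover (P := @SurjectiveOnStalks) 𝒰).mpr fun i => inferInstance
  have hinj : Function.Injective G := by
    intro x y hxy
    obtain ⟨i, x, rfl⟩ := 𝒰.exists_eq x
    have hy : y ∈ (𝒰.f i).opensRange := by
      rw [← hV]
      change G y ∈ V i
      rw [← hxy]
      change _ ∈ G ⁻¹ᵁ V i
      rw [hV]
      exact ⟨x, rfl⟩
    obtain ⟨y, rfl⟩ := hy
    rw [← Scheme.Hom.comp_apply, ← Scheme.Hom.comp_apply] at hxy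
    rw [(𝒰.f i ≫ G).isEmbedding.injective hxy]
  have := SurjectiveOnStalks.mono_of_injective hinj
  exact (IsClosedImmersion.iff_isProper_and_mono G).mpr ⟨inferInstance, this⟩

end Glue

/-! ### Projectivity of schemes that are finite over projective space -/

section Coordinates

variable {K E : Type*} [Field K] [Field E] [Algebra K E]

/-- Homogeneous coordinates in a field for a projective embedding that refines a given system of
charts. -/
theorem exists_adjoin_div_eq {ι : Type*} [Finite ι] [Nonempty ι] (g : ι → E) (hg : ∀ i, g i ≠ 0)
    (R : ι → Subalgebra K E) (hR : ∀ i, (R i).FG) (hgR : ∀ i j, g j / g i ∈ R i)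
    (hclear : ∀ i, ∀ b ∈ R i, ∀ j, ∃ m : ℕ, b * (g i / g j) ^ m ∈ R j) :
    ∃ (N m : ℕ) (v : Fin (N + 1) → E) (e : ι → Fin (N + 1)), 0 < m ∧ (∀ i, v (e i) = g i ^ m) ∧
      ∀ i, Algebra.adjoin K (Set.range fun k => v k / g i ^ m) = R i := by
  classical
  have := Fintype.ofFinite ι
  choose S hS using hR
  have hSR : ∀ i, ∀ b ∈ S i, b ∈ R i := fun i b hb => hS i ▸ Algebra.subset_adjoin hb
  have h1 : ∀ (k : Σ i, S i) (j : ι), ∃ m : ℕ, (k.2 : E) * (g k.1 / g j) ^ m ∈ R j :=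
    fun k j => hclear k.1 _ (hSR _ _ k.2.2) j
  choose M hM using h1
  -- The sum dominates all the exponents at once; adding one makes `m` positive.
  let m : ℕ := ∑ k, ∑ j, M k j + 1
  have hm : ∀ (k : Σ i, S i) (j : ι), (k.2 : E) * (g k.1 / g j) ^ m ∈ R j := by
    intro k j
    have hle : M k j ≤ m :=
      ((Finset.single_le_sum (f := M k) (fun _ _ => Nat.zero_le _) (Finset.mem_univ j)).trans
        (Finset.single_le_sum (f := fun k => ∑ j, M k j) (fun _ _ => Nat.zero_le _)
          (Finset.mem_univ k))).trans (Nat.le_succ _)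
    rw [← Nat.add_sub_cancel' hle, pow_add, ← mul_assoc]
    exact mul_mem (hM k j) (pow_mem (hgR j k.1) _)
  -- The coordinates are gᵢ^m and b·gᵢ^m for the generators b of Rᵢ; division by gᵢ^m returns those
  -- generators.
  let v : ι ⊕ (Σ i, S i) → E := Sum.elim (fun i => g i ^ m) fun k => k.2 * g k.1 ^ m
  obtain ⟨N, hN⟩ := Nat.exists_eq_succ_of_ne_zero
    (Fintype.card_ne_zero (α := ι ⊕ (Σ i, S i)))
  let e := Fintype.equivFinOfCardEq hN
  refine ⟨N, m, v ∘ e.symm, fun i => e (Sum.inl i), Nat.succ_pos _, fun i => by simp [v],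
    fun i => le_antisymm (Algebra.adjoin_le ?_) ?_⟩
  · rintro _ ⟨k, rfl⟩
    obtain ⟨k, rfl⟩ := e.surjective k
    simp only [Function.comp_apply, Equiv.symm_apply_apply, SetLike.mem_coe]
    rcases k with j | k
    · simp only [v, Sum.elim_inl, ← div_pow]
      exact pow_mem (hgR i j) _
    · simp only [v, Sum.elim_inr, mul_div_assoc, ← div_pow]
      exact hm k i
  · rw [← hS i]
    refine Algebra.adjoin_mono fun b hb => ⟨e (Sum.inr ⟨i, b, hb⟩), ?_⟩
    simp [v, hg i]

end Coordinates

/-! ### Quotients of linear forms on `Proj`. -/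

section Ratio

open HomogeneousLocalization

variable {σ : Type*} {A : Type u} [CommRing A] [SetLike σ A]
  [AddSubgroupClass σ A] {𝒜 : ℕ → σ} [GradedRing 𝒜]

/-- The quotient of two elements of degree one. -/
def ratio {t s : A} (ht : t ∈ 𝒜 1) (hs : s ∈ 𝒜 1) : Away 𝒜 t :=
  Away.mk 𝒜 ht 1 s (by simpa using hs)

theorem ratio_self {t : A} (ht : t ∈ 𝒜 1) : ratio ht ht = 1 := by
  apply val_injective
  rw [ratio, Away.val_mk, val_one, Localization.mk_eq_mk', IsLocalization.mk'_eq_iff_eq_mul]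
  simp

theorem awayMap_ratio_mul_awayMap_ratio {t s r : A} (ht : t ∈ 𝒜 1) (hs : s ∈ 𝒜 1) (hr : r ∈ 𝒜 1) :
    awayMap 𝒜 hs rfl (ratio ht hs) * awayMap 𝒜 ht (mul_comm t s) (ratio hs hr) =
      awayMap 𝒜 hs rfl (ratio ht hr) := by
  apply val_injective
  rw [ratio, ratio, ratio, awayMap_mk, awayMap_mk, awayMap_mk, val_mul, Away.val_mk, Away.val_mk,
    Away.val_mk, Localization.mk_mul, Localization.mk_eq_mk_iff, Localization.r_iff_exists]
  refine ⟨1, ?_⟩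
  simp only [OneMemClass.coe_one, Submonoid.coe_mul]
  ring

theorem basicOpen_awayToSection_ratio {t s : A} (ht : t ∈ 𝒜 1) (hs : s ∈ 𝒜 1) :
    (Proj 𝒜).basicOpen (Proj.awayToSection 𝒜 t (ratio ht hs)) =
      Proj.basicOpen 𝒜 t ⊓ Proj.basicOpen 𝒜 s := by
  ext x
  have key : ∀ hxt : x ∈ Proj.basicOpen 𝒜 t,
      x ∈ (Proj 𝒜).basicOpen (Proj.awayToSection 𝒜 t (ratio ht hs)) ↔
        x ∈ Proj.basicOpen 𝒜 s := by
    intro hxt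
    have hprime : x.asHomogeneousIdeal.toIdeal.IsPrime := ProjectiveSpectrum.isPrime x
    let e := Proj.stalkIso' 𝒜 x
    have hxt' : t ∈ x.asHomogeneousIdeal.toIdeal.primeCompl := hxt
    have h := ProjectiveSpectrum.Proj.awayToSection_germ 𝒜 t x hxt
    have h1 : (Proj 𝒜).presheaf.germ _ x hxt (Proj.awayToSection 𝒜 t (ratio ht hs)) =
      e.symm (mapId 𝒜 (Submonoid.powers_le.mpr hxt') (ratio ht hs)) :=
      congr($h (ratio ht hs))
    have h2 : IsUnit ((Proj 𝒜).presheaf.germ _ x hxt (Proj.awayToSection 𝒜 t (ratio ht hs))) ↔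
        IsUnit (mapId 𝒜 (Submonoid.powers_le.mpr hxt') (ratio ht hs)) := by
      rw [h1]
      exact MulEquiv.isUnit_map e.symm
    rw [Scheme.mem_basicOpen _ _ _ hxt, h2]
    refine (isUnit_iff_isUnit_val _ _ _).symm.trans ?_
    have h3 : (mapId 𝒜 (Submonoid.powers_le.mpr hxt') (ratio ht hs)).val =
        IsLocalization.mk' (Localization.AtPrime x.asHomogeneousIdeal.toIdeal) s
          ⟨t ^ 1, (Submonoid.powers_le.mpr hxt') ⟨1, rfl⟩⟩ := by
      rw [← Localization.mk_eq_mk']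
      rfl
    rw [h3, IsLocalization.AtPrime.isUnit_mk'_iff _ x.asHomogeneousIdeal.toIdeal]
    rfl
  constructor
  · intro hx
    have hxt : x ∈ Proj.basicOpen 𝒜 t := (Proj 𝒜).basicOpen_le _ hx
    exact ⟨hxt, (key hxt).mp hx⟩
  · rintro ⟨hxt, hxs⟩
    exact (key hxt).mpr hxs

end Ratio

/-! ### Projective embeddings from affine charts with transition functions. -/

section Charts

variable {K : Type u} [Field K]

/-- Clearing denominators: a section over an open set that contains a basic open set. -/
theorem exists_germ_eq_mul_pow {X : Scheme.{u}} [IsIntegral X] {U V : X.Opens}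
    (hU : IsAffineOpen U) [Nonempty U] [Nonempty V] (a : Γ(X, U)) [hne : Nonempty (X.basicOpen a)]
    (hV : X.basicOpen a ≤ V) (b : Γ(X, V)) : ∃ (m : ℕ) (c : Γ(X, U)),
      X.germToFunctionField U c = X.germToFunctionField V b * X.germToFunctionField U a ^ m := by
  have := hU.isLocalization_basicOpen a
  obtain ⟨m, c, hc⟩ := IsLocalization.Away.surj a (X.presheaf.map (homOfLE hV).op b)
  refine ⟨m, c, ?_⟩
  have h : ∀ (W : X.Opens) [Nonempty W] (hW : X.basicOpen a ≤ W) (z : Γ(X, W)),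
      X.germToFunctionField (X.basicOpen a) (X.presheaf.map (homOfLE hW).op z) =
        X.germToFunctionField W z := fun W _ hW z => X.presheaf.germ_res_apply (homOfLE hW) _ _ z
  have hc' : X.presheaf.map (homOfLE hV).op b * (X.presheaf.map (homOfLE (X.basicOpen_le a)).op a) ^ m
    = X.presheaf.map (homOfLE (X.basicOpen_le a)).op c := hc
  have := congrArg (X.germToFunctionField (X.basicOpen a)) hc'
  rw [map_mul, map_pow, h, h, h] at this
  exact this.symm

/-- The scalars in the ring of sections of a scheme over a field. -/
def scalars (X : Over (Spec (CommRingCat.of K))) (U : X.left.Opens) : K →+* Γ(X.left, U) :=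
  ((Scheme.ΓSpecIso (CommRingCat.of K)).inv ≫ X.hom.appLE ⊤ U le_top).hom

theorem fromSpec_comp_hom (X : Over (Spec (CommRingCat.of K))) {U : X.left.Opens}
    (hU : IsAffineOpen U) :
    hU.fromSpec ≫ X.hom = Spec.map (CommRingCat.ofHom (scalars X U)) := by
  rw [← IsAffineOpen.SpecMap_appLE_fromSpec X.hom (isAffineOpen_top _) hU le_top,
    IsAffineOpen.fromSpec_top, scalars, CommRingCat.ofHom_hom, Spec.map_comp,
    Scheme.isoSpec_Spec_inv]

theorem finiteType_scalars (X : Over (Spec (CommRingCat.of K))) [LocallyOfFiniteType X.hom]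
    {U : X.left.Opens} (hU : IsAffineOpen U) : (scalars X U).FiniteType := by
  exact (X.hom.finiteType_appLE (isAffineOpen_top _) hU le_top).comp (.of_surjective _
    (ConcreteCategory.bijective_of_isIso (Scheme.ΓSpecIso (CommRingCat.of K)).inv).2)

theorem fromGeneric_eq {X : Scheme.{u}} [IsIntegral X] {U : X.Opens} (hU : IsAffineOpen U)
    [Nonempty U] : Spec.map (X.germToFunctionField U) ≫ hU.fromSpec = fromGeneric X :=
  hU.fromSpecStalk_eq_fromSpecStalk _

theorem eval₂_mul_of_isHomogeneous {R S : Type*} [CommSemiring R] [CommSemiring S] {n : ℕ}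
    {ι : Type*} [Fintype ι] (f : R →+* S) (v : ι → S) (u : S) {p : MvPolynomial ι R}
    (hp : p.IsHomogeneous n) :
    p.eval₂ f (fun k => u * v k) = u ^ n * p.eval₂ f v := by
  rw [MvPolynomial.eval₂_eq', MvPolynomial.eval₂_eq', Finset.mul_sum]
  refine Finset.sum_congr rfl fun d hd => ?_
  have hdeg : ∑ i, d i = n := by
    have := hp (MvPolynomial.mem_support_iff.mp hd)
    rw [Finsupp.weight_apply, Finsupp.sum_fintype _ _ (by simp)] at this
    simpa using this
  simp only [mul_pow, Finset.prod_mul_distrib, Finset.prod_pow_eq_pow_sum, hdeg]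
  ring

variable {n : ℕ}

theorem X_mem_homogeneousSubmodule (k : Fin n) :
    MvPolynomial.X k ∈ MvPolynomial.homogeneousSubmodule (Fin n) K 1 :=
  MvPolynomial.isHomogeneous_X K k

/-- The homogeneous fractions generate: the chart of a map to projective space is surjective on
functions as soon as the coordinates generate. -/
theorem exists_liftAway_eq {R E : Type u} [CommRing R] [Field E] [Algebra K E] (κ : K →+* R)
    (γ : R →+* E) (hγ : γ.comp κ = algebraMap K E) (w : Fin n → R) (k₀ : Fin n)
    (hk₀ : w k₀ = 1) (hu : IsUnit (MvPolynomial.eval₂Hom κ w (MvPolynomial.X k₀))) {x : E}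
    (hx : x ∈ Algebra.adjoin K (Set.range fun k => γ (w k))) :
    ∃ z, γ (liftAway (MvPolynomial.homogeneousSubmodule (Fin n) K) (MvPolynomial.eval₂Hom κ w) hu z)
      = x := by
  induction hx using Algebra.adjoin_induction with
  | mem x hx =>
    obtain ⟨k, rfl⟩ := hx
    refine ⟨ratio (X_mem_homogeneousSubmodule k₀) (X_mem_homogeneousSubmodule k), ?_⟩
    have := liftAway_mk (𝒜 := MvPolynomial.homogeneousSubmodule (Fin n) K)
      (MvPolynomial.eval₂Hom κ w) hu (X_mem_homogeneousSubmodule k₀) 1 (MvPolynomial.X k)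
      (by simpa using X_mem_homogeneousSubmodule k)
    simp only [MvPolynomial.eval₂Hom_X', hk₀, one_pow, mul_one] at this
    exact congrArg γ this
  | algebraMap r =>
    refine ⟨HomogeneousLocalization.fromZeroRingHom _ _
      (algebraMap K (MvPolynomial.homogeneousSubmodule (Fin n) K 0) r), ?_⟩
    rw [liftAway_comp_fromZeroRingHom, ← hγ]
    exact congrArg γ (MvPolynomial.eval₂Hom_C κ w r)
  | add x y _ _ hx hy =>
    obtain ⟨z, rfl⟩ := hx
    obtain ⟨z', rfl⟩ := hy
    exact ⟨z + z', by rw [map_add, map_add]⟩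
  | mul x y _ _ hx hy =>
    obtain ⟨z, rfl⟩ := hx
    obtain ⟨z', rfl⟩ := hy
    exact ⟨z * z', by rw [map_mul, map_mul]⟩

/-- The gᵢ play the role of sections of a line bundle whose nonvanishing loci are the affine sets
Uᵢ. A power of the bundle is very ample: enough coordinates are added to generate every Γ(X, Uᵢ). -/
theorem exists_isClosedImmersion_of_charts (X : Over (Spec (CommRingCat.of K)))
    [IsIntegral X.left] [IsProper X.hom] {ι : Type} [Finite ι] [Nonempty ι]
    (U : ι → X.left.Opens) (hU : ∀ i, IsAffineOpen (U i)) [∀ i, Nonempty (U i)]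
    (hcov : ∀ x, ∃ i, x ∈ U i) (g : ι → X.left.functionField) (hg : ∀ i, g i ≠ 0)
    (a : ∀ i, ι → Γ(X.left, U i))
    (ha : ∀ i j, X.left.germToFunctionField (U i) (a i j) = g j / g i)
    (hab : ∀ i j, X.left.basicOpen (a i j) = U i ⊓ U j) :
    ∃ (N : ℕ) (i : X ⟶ projSpace K N), IsClosedImmersion i.left := by
  let E := X.left.functionField
  let γ (i : ι) : Γ(X.left, U i) →+* E := (X.left.germToFunctionField (U i)).hom
  have hγinj : ∀ i, Function.Injective (γ i) := fun i => X.left.germToFunctionField_injective (U i)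
  obtain ⟨i₀⟩ := ‹Nonempty ι›
  let κ : K →+* E := (γ i₀).comp (scalars X (U i₀))
  have : Nonempty (⊤ : X.left.Opens) := ⟨⟨genericPoint X.left, trivial⟩⟩
  have hκ : ∀ i, (γ i).comp (scalars X (U i)) = κ := by
    have h : ∀ i, (γ i).comp (scalars X (U i)) =
        (X.left.germToFunctionField ⊤).hom.comp (scalars X ⊤) := by
      intro i
      ext r
      have h1 : scalars X (U i) r = X.left.presheaf.map (homOfLE le_top).op (scalars X ⊤ r) := by
        simp only [scalars]
        rw [← Scheme.Hom.appLE_map X.hom (le_top : ⊤ ≤ X.hom ⁻¹ᵁ ⊤) (homOfLE le_top).op]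
        rfl
      rw [RingHom.comp_apply, h1]
      exact X.left.presheaf.germ_res_apply (homOfLE le_top) _ _ _
    intro i
    rw [h, ← h i₀]
  let : Algebra K E := κ.toAlgebra
  let γ' (i : ι) : letI := (scalars X (U i)).toAlgebra; Γ(X.left, U i) →ₐ[K] E :=
    letI := (scalars X (U i)).toAlgebra
    { γ i with commutes' := fun r => congr($(hκ i) r) }
  let R (i : ι) : Subalgebra K E := letI := (scalars X (U i)).toAlgebra; (γ' i).range
  have hmemR : ∀ i x, x ∈ R i ↔ ∃ y, γ i y = x := fun i x => Iff.rfl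
  have hne : ∀ i j, Nonempty (X.left.basicOpen (a i j)) := by
    intro i j
    rw [hab]
    obtain ⟨x⟩ : Nonempty (U i) := inferInstance
    obtain ⟨y⟩ : Nonempty (U j) := inferInstance
    obtain ⟨z, hz⟩ := nonempty_preirreducible_inter (U i).isOpen (U j).isOpen ⟨x.1, x.2⟩ ⟨y.1, y.2⟩
    exact ⟨⟨z, hz⟩⟩
  obtain ⟨N, m, v, e, hm, hve, hv⟩ := exists_adjoin_div_eq (K := K) (E := E) g hg R (fun i => by
      let := (scalars X (U i)).toAlgebra
      have : Algebra.FiniteType K Γ(X.left, U i) := finiteType_scalars X (hU i)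
      exact (Algebra.FiniteType.out (R := K) (A := Γ(X.left, U i))).map (γ' i) |> fun h => by
        rwa [Algebra.map_top] at h)
    (fun i j => (hmemR _ _).mpr ⟨a i j, ha i j⟩) (by
      rintro i _ ⟨b, rfl⟩ j
      obtain ⟨k, c, hc⟩ := exists_germ_eq_mul_pow (hU j) (a j i) ((hab j i).trans_le inf_le_right) b
      rw [ha] at hc
      exact ⟨k, (hmemR _ _).mpr ⟨c, hc⟩⟩)
  have hw : ∀ i k, ∃ y, γ i y = v k / g i ^ m := fun i k =>
    (hmemR _ _).mp (hv i ▸ Algebra.subset_adjoin ⟨k, rfl⟩)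
  choose w hw using hw
  have hg' : ∀ i, g i ^ m ≠ 0 := fun i => pow_ne_zero _ (hg i)
  have hwe : ∀ i, w i (e i) = 1 := fun i => hγinj i (by rw [hw, hve, div_self (hg' i), map_one])
  have hwa : ∀ i j, w i (e j) = a i j ^ m := fun i j => hγinj i (by
    rw [hw, hve, ← div_pow, map_pow]
    exact congrArg (· ^ m) (ha i j).symm)
  let 𝒜 := MvPolynomial.homogeneousSubmodule (Fin (N + 1)) K
  let f (i : ι) := MvPolynomial.eval₂Hom (scalars X (U i)) (w i)
  have hf : ∀ i, IsUnit (f i (MvPolynomial.X (e i))) := fun i => by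
    rw [MvPolynomial.eval₂Hom_X', hwe]
    exact isUnit_one
  let h (i : ι) : Spec Γ(X.left, U i) ⟶ Proj 𝒜 :=
    projPoint (f i) (hf i) (X_mem_homogeneousSubmodule (e i)) one_pos
  let F : MvPolynomial (Fin (N + 1)) K →+* E := MvPolynomial.eval₂Hom κ v
  have hF : ∀ i, IsUnit (F (MvPolynomial.X (e i))) := fun i => by
    rw [MvPolynomial.eval₂Hom_X', hve]
    exact (hg' i).isUnit
  have hfγ : ∀ i, IsUnit (((γ i).comp (f i)) (MvPolynomial.X (e i))) := fun i => (hf i).map (γ i)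
  -- On chart i the coordinates are v divided by gᵢ^m, so at the generic point all charts give the
  -- same point up to rescaling.
  have hgen : ∀ i, Spec.map (CommRingCat.ofHom (γ i)) ≫ h i =
      projPoint F (hF i₀) (X_mem_homogeneousSubmodule (e i₀)) one_pos := by
    intro i
    rw [projPoint_eq F (hF i₀) (hF i) (X_mem_homogeneousSubmodule (e i₀)) one_pos
      (X_mem_homogeneousSubmodule (e i)) one_pos]
    refine (Spec_map_projPoint (f i) (γ i) (hf i) _ _ (hfγ i)).trans ?_
    rw [projPoint, projPoint, liftAway_eq_of_smul (f := F) (g := (γ i).comp (f i)) (g i ^ m)⁻¹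
      (X_mem_homogeneousSubmodule (e i)) (hF i) (hfγ i)]
    intro d p hp
    have h1 : (γ i).comp (f i) p = MvPolynomial.eval₂ κ (fun k => (g i ^ m)⁻¹ * v k) p := by
      change γ i (MvPolynomial.eval₂ _ _ p) = _
      rw [MvPolynomial.hom_eval₂, hκ]
      congr 1
      funext k
      change γ i (w i k) = _
      rw [hw, div_eq_inv_mul]
    rw [h1, eval₂_mul_of_isHomogeneous κ v _ hp]
    rfl
  choose idx hidx using hcov
  let 𝒰 : X.left.AffineOpenCover :=
    { I₀ := ι
      X := fun i => Γ(X.left, U i)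
      f := fun i => (hU i).fromSpec
      idx := idx
      covers := fun x => by
        rw [(hU _).range_fromSpec]
        exact hidx x }
  obtain ⟨G, hG⟩ := exists_glueMorphisms (P := Proj 𝒜) 𝒰.openCover (fromGeneric X.left)
    (fun i => Spec.map (CommRingCat.ofHom (γ i))) (fun i : ι => fromGeneric_eq (hU i)) h _ hgen
  replace hG : ∀ i, (hU i).fromSpec ≫ G = h i := hG
  have hGK : G ≫ (projSpace K N).hom = X.hom := by
    refine 𝒰.openCover.hom_ext _ _ fun i => ?_
    change (hU i).fromSpec ≫ G ≫ Proj.toSpecZero 𝒜 ≫ _ = (hU i).fromSpec ≫ X.hom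
    rw [reassoc_of% (hG i), fromSpec_comp_hom]
    simp only [h, projPoint, Category.assoc]
    rw [Proj.awayι_toSpecZero_assoc, ← Spec.map_comp, ← Spec.map_comp]
    congr 1
    ext r
    exact (liftAway_comp_fromZeroRingHom (𝒜 := 𝒜) (f i) (hf i) _).trans
      (MvPolynomial.eval₂Hom_C _ _ r)
  refine ⟨N, Over.homMk G hGK, ?_⟩
  change IsClosedImmersion G
  let G' : X.left ⟶ (projSpace K N).left := G
  have : IsProper (G' ≫ (projSpace K N).hom) := by
    have h : G' ≫ (projSpace K N).hom = X.hom := hGK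
    rwa [h]
  have hproj : IsProper (projSpace K N).hom := inferInstance
  have : IsSeparated (projSpace K N).hom := hproj.toIsSeparated
  have : IsProper G := IsProper.of_comp G' (projSpace K N).hom
  have himm : ∀ i, IsPreimmersion ((hU i).fromSpec ≫ G) := by
    intro i
    rw [hG]
    have : IsClosedImmersion (Spec.map (CommRingCat.ofHom (liftAway 𝒜 (f i) (hf i)))) := by
      refine IsClosedImmersion.spec_of_surjective _ fun b => ?_
      have hb : γ i b ∈ Algebra.adjoin K (Set.range fun k => γ i (w i k)) := by
        simp only [hw, hv]
        exact (hmemR _ _).mpr ⟨b, rfl⟩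
      obtain ⟨z, hz⟩ :=
        exists_liftAway_eq (scalars X (U i)) (γ i) (hκ i) (w i) (e i) (hwe i) (hf i) hb
      exact ⟨z, hγinj i hz⟩
    change IsPreimmersion (Spec.map (CommRingCat.ofHom (liftAway 𝒜 (f i) (hf i))) ≫
      Proj.awayι 𝒜 _ (X_mem_homogeneousSubmodule (e i)) one_pos)
    infer_instance
  -- On Uⱼ the coordinate of index e(i) is (gᵢ/gⱼ)^m with m > 0, whose nonvanishing locus is Uᵢ ∩
  -- Uⱼ.
  have hpre : ∀ i j, (hU j).fromSpec ⁻¹ᵁ (G ⁻¹ᵁ Proj.basicOpen 𝒜 (MvPolynomial.X (e i))) =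
      (hU j).fromSpec ⁻¹ᵁ (U i) := by
    intro i j
    rw [← Scheme.Hom.comp_preimage, hG]
    refine (projPoint_preimage_basicOpen (f j) (hf j) (X_mem_homogeneousSubmodule (e j)) one_pos
      (X_mem_homogeneousSubmodule (e i)) one_pos).trans ?_
    rw [MvPolynomial.eval₂Hom_X', hwa, PrimeSpectrum.basicOpen_pow _ _ hm,
      ← (hU j).fromSpec_preimage_basicOpen, hab, Scheme.Hom.preimage_inf,
      (hU j).fromSpec_preimage_self, top_inf_eq]
  refine isClosedImmersion_of_openCover 𝒰.openCover G himm
    (fun i => Proj.basicOpen 𝒜 (MvPolynomial.X (e i))) (fun i => ?_)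
  refine Eq.trans ?_ (hU i).opensRange_fromSpec.symm
  ext x
  obtain ⟨j, x, rfl⟩ := 𝒰.openCover.exists_eq x
  exact congr(x ∈ $(hpre i j)).to_iff

end Charts

/-! ### Pulling back homogeneous coordinates along an affine morphism. -/

section FiniteOverProj

theorem evalAt_map {E : Type u} [Field E] {X : Scheme.{u}} (s : Spec (CommRingCat.of E) ⟶ X)
    {U V : X.Opens} (hUV : U ≤ V) (h : ⊤ ≤ s ⁻¹ᵁ U) (h' : ⊤ ≤ s ⁻¹ᵁ V) (a : Γ(X, V)) :
    evalAt s U h (X.presheaf.map (homOfLE hUV).op a) = evalAt s V h' a := by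
  rw [evalAt, evalAt, ← Scheme.Hom.map_appLE s h (homOfLE hUV).op]
  rfl

/-- The coordinates of a point of `Proj` with values in a field. -/
theorem evalAt_awayToSection_ratio_mul {σ : Type*} {A E : Type u} [CommRing A] [SetLike σ A]
    [AddSubgroupClass σ A] {𝒜 : ℕ → σ} [GradedRing 𝒜] [Field E]
    (s : Spec (CommRingCat.of E) ⟶ Proj 𝒜) {x y z : A} (hx : x ∈ 𝒜 1) (hy : y ∈ 𝒜 1)
    (hz : z ∈ 𝒜 1) (hsx : ⊤ ≤ s ⁻¹ᵁ Proj.basicOpen 𝒜 x) (hsy : ⊤ ≤ s ⁻¹ᵁ Proj.basicOpen 𝒜 y) :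
    evalAt s _ hsx (Proj.awayToSection 𝒜 x (ratio hx hy)) *
      evalAt s _ hsy (Proj.awayToSection 𝒜 y (ratio hy hz)) =
      evalAt s _ hsx (Proj.awayToSection 𝒜 x (ratio hx hz)) := by
  have hxy : ⊤ ≤ s ⁻¹ᵁ Proj.basicOpen 𝒜 (x * y) := by
    rw [Proj.basicOpen_mul]
    exact fun p _ => ⟨hsx trivial, hsy trivial⟩
  have h1 : ∀ r, evalAt s _ hsx (Proj.awayToSection 𝒜 x r) = evalAt s _ hxy
      (Proj.awayToSection 𝒜 (x * y) (HomogeneousLocalization.awayMap 𝒜 hy rfl r)) := by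
    intro r
    have := congr($(Proj.awayMap_awayToSection 𝒜 (f := x) hy (x := x * y) rfl) r)
    refine Eq.trans ?_ (congrArg _ this.symm)
    exact (evalAt_map s _ hxy hsx _).symm
  have h2 : ∀ r, evalAt s _ hsy (Proj.awayToSection 𝒜 y r) = evalAt s _ hxy
      (Proj.awayToSection 𝒜 (x * y) (HomogeneousLocalization.awayMap 𝒜 hx (mul_comm x y) r)) := by
    intro r
    have := congr($(Proj.awayMap_awayToSection 𝒜 (f := y) hx (x := x * y) (mul_comm x y)) r)
    refine Eq.trans ?_ (congrArg _ this.symm)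
    exact (evalAt_map s _ hxy hsy _).symm
  rw [h1, h2, h1, ← map_mul, ← map_mul, awayMap_ratio_mul_awayMap_ratio]

variable {K : Type u} [Field K]

/-- An integral scheme that is proper over a field and affine over a projective space is
projective. -/
theorem exists_isClosedImmersion_of_isAffineHom {X : Over (Spec (CommRingCat.of K))}
    [IsIntegral X.left] [IsProper X.hom] {n : ℕ} (q : X ⟶ projSpace K n) [hq : IsAffineHom q.left] :
    ∃ (N : ℕ) (i : X ⟶ projSpace K N), IsClosedImmersion i.left := by
  let 𝒜 := MvPolynomial.homogeneousSubmodule (Fin (n + 1)) K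
  let q' : X.left ⟶ Proj 𝒜 := q.left
  have hq' : IsAffineHom q' := hq
  let D (i : Fin (n + 1)) : (Proj 𝒜).Opens := Proj.basicOpen 𝒜 (MvPolynomial.X i)
  have hX (i : Fin (n + 1)) : MvPolynomial.X i ∈ 𝒜 1 := X_mem_homogeneousSubmodule i
  have hcov : ∀ x, ∃ i, x ∈ q' ⁻¹ᵁ D i := by
    intro x
    have h : ⨆ i, D i = ⊤ := by
      refine Proj.iSup_basicOpen_eq_top' 𝒜 _ (fun i => ⟨1, hX i⟩) ?_
      refine eq_top_iff.mpr fun p _ => ?_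
      induction p using MvPolynomial.induction_on with
      | C a =>
        exact Subalgebra.algebraMap_mem _
          (⟨MvPolynomial.C a, MvPolynomial.isHomogeneous_C _ a⟩ : 𝒜 0)
      | add p p' hp hp' => exact add_mem (hp trivial) (hp' trivial)
      | mul_X p i hp => exact mul_mem (hp trivial) (Algebra.subset_adjoin ⟨i, rfl⟩)
    have hx : q' x ∈ ⨆ i, D i := h ▸ trivial
    exact (TopologicalSpace.Opens.mem_iSup (x := q' x)).mp hx
  -- Only coordinates not vanishing at the generic point are kept, so that their quotients are
  -- nonzero rational functions.
  let ι := {i // Nonempty (q' ⁻¹ᵁ D i)}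
  have hne (i : ι) : Nonempty (q' ⁻¹ᵁ D i) := i.2
  have hcov' : ∀ x, ∃ i : ι, x ∈ q' ⁻¹ᵁ D i := fun x => by
    obtain ⟨i, hi⟩ := hcov x
    exact ⟨⟨i, ⟨⟨x, hi⟩⟩⟩, hi⟩
  obtain ⟨i₀, -⟩ := hcov' (genericPoint X.left)
  have : Nonempty ι := ⟨i₀⟩
  let η : Spec X.left.functionField ⟶ Proj 𝒜 := fromGeneric X.left ≫ q'
  have hη (i : ι) : ⊤ ≤ η ⁻¹ᵁ D i :=
    top_le_preimage_of_nonempty (E := X.left.functionField) (fromGeneric X.left) (q' ⁻¹ᵁ D i)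
  let r (i : ι) (j : Fin (n + 1)) : X.left.functionField :=
    evalAt (E := X.left.functionField) η _ (hη i)
      (Proj.awayToSection 𝒜 _ (ratio (hX i) (hX j)))
  have hr (i j : ι) (k : Fin (n + 1)) : r i j * r j k = r i k :=
    evalAt_awayToSection_ratio_mul (E := X.left.functionField) η (hX i) (hX j) (hX k) (hη i) (hη j)
  have hr1 (i : ι) : r i i = 1 := by
    simp only [r, ratio_self, map_one]
  have hr0 (i : ι) : r i₀ i ≠ 0 := fun h => by
    have := hr i₀ i i₀
    rw [h, zero_mul, hr1] at this
    exact zero_ne_one this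
  refine exists_isClosedImmersion_of_charts X (ι := ι) (fun i => q' ⁻¹ᵁ D i)
    (fun i => (Proj.isAffineOpen_basicOpen 𝒜 _ (hX i) one_pos).preimage q') hcov'
    (fun i => r i₀ i) hr0
    (fun i j => q'.app (D i) (Proj.awayToSection 𝒜 _ (ratio (hX i) (hX j)))) (fun i j => ?_)
    (fun i j => ?_)
  · rw [eq_div_iff (hr0 i), mul_comm, ← hr i₀ i j]
    congr 1
    have h : ⊤ ≤ fromGeneric X.left ⁻¹ᵁ (q' ⁻¹ᵁ D i) := hη i
    rw [← evalAt_fromGeneric _ h]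
    exact evalAt_comp (E := X.left.functionField) (fromGeneric X.left) q' _ h (hη i) _
  · refine (Scheme.preimage_basicOpen q' _).symm.trans ?_
    rw [basicOpen_awayToSection_ratio, Scheme.Hom.preimage_inf]

end FiniteOverProj

/-! ### Curves attached to intermediate fields -/

section Intermediate

/-- Surjectivity survives base change, and a continuous image of an irreducible space is
irreducible. -/
theorem geometricallyIrreducible_of_surjective {X Y S : Scheme.{u}} (t : X ⟶ Y) (f : Y ⟶ S)
    [Surjective t] [h : GeometricallyIrreducible (t ≫ f)] : GeometricallyIrreducible f := by
  refine ⟨fun L _ y Z fst snd hZ => ?_⟩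
  have hZ' : IsPullback (Limits.pullback.fst t fst) (Limits.pullback.snd t fst) t fst :=
    .of_hasPullback _ _
  have : IrreducibleSpace (Limits.pullback t fst : Scheme.{u}) :=
    h.geometrically_irreducibleSpace y _ _ (hZ'.paste_vert hZ)
  change IrreducibleSpace Z
  rw [irreducibleSpace_def, Set.top_eq_univ, ← (Limits.pullback.snd t fst).surjective.range_eq, ← Set.image_univ]
  exact (IrreducibleSpace.isIrreducible_univ _).image _
    (Limits.pullback.snd t fst).continuous.continuousOn

variable {K : Type u} [Field K] {C D : Over (Spec (CommRingCat.of K))} [hC : IsCurve C]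
  [hD : IsCurve D]

theorem IsCurve.isDedekindDomain (U : C.left.Opens) (hU : IsAffineOpen U) (hne : Nonempty U) :
    IsDedekindDomain Γ(C.left, U) :=
  isDedekindDomain_of_isAffineOpen (fun _ => inferInstance) hU

/-- An extension of the function field of a curve that embeds into that of a cover is the function
field of an intermediate curve. -/
theorem exists_isCurve_of_functionField (f : C ⟶ D) (hf : IsNonconstant f) (E : Type u) [Field E]
    [Algebra D.left.functionField E] [FiniteDimensional D.left.functionField E]
    [Algebra.IsSeparable D.left.functionField E] (j : E →+* C.left.functionField)
    (hj : j.comp (algebraMap D.left.functionField E) = functionFieldMap f hf) :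
    ∃ (X : Over (Spec (CommRingCat.of K))) (_ : IsCurve X) (g : C ⟶ X) (h : X ⟶ D)
      (hg : IsNonconstant g) (hh : IsNonconstant h) (σ : X.left.functionField →+* E),
      g ≫ h = f ∧ Function.Bijective σ ∧ functionFieldMap g hg = j.comp σ ∧
        σ.comp (functionFieldMap h hh) = algebraMap D.left.functionField E := by
  have hfin : IsFinite (normalizationInMap D.left E) :=
    isFinite_normalizationInMap E IsCurve.isDedekindDomain
  obtain ⟨σ, hσ, hσ'⟩ := exists_functionField_normalizationIn (Y := D.left) E
  have hjmap : Spec.map (CommRingCat.ofHom j) ≫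
      Spec.map (CommRingCat.ofHom (algebraMap D.left.functionField E)) =
      Spec.map (CommRingCat.ofHom (functionFieldMap f hf)) :=
    (Spec.map_comp _ _).symm.trans (congrArg (fun θ => Spec.map (CommRingCat.ofHom θ)) hj)
  obtain ⟨t, ht, ht'⟩ := exists_lift_of_isIntegralHom (X := C.left)
    (fun U hU hne => by
      have := IsCurve.isDedekindDomain U hU hne
      infer_instance)
    (normalizationInMap D.left E) f.left
    (Spec.map (CommRingCat.ofHom j) ≫ (genericPointMap D.left E).toNormalization) (by
      rw [Category.assoc, Scheme.Hom.toNormalization_fromNormalization, genericPointMap,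
        ← Category.assoc, ← Spec_map_functionFieldMap f hf]
      exact congrArg (· ≫ fromGeneric D.left) hjmap)
  have hffin : IsFinite f.left := hf.isFinite
  have htfin : IsFinite t := by
    have : IsFinite (t ≫ normalizationInMap D.left E) := by rwa [ht]
    exact .of_comp t (normalizationInMap D.left E)
  have htdom : IsDominant t := by
    have : IsDominant (fromGeneric C.left ≫ t) := by
      rw [ht']
      have : Surjective (Spec.map (CommRingCat.ofHom j)) := by
        refine ⟨fun x => ⟨IsLocalRing.closedPoint C.left.functionField, ?_⟩⟩
        exact Subsingleton.elim (α := PrimeSpectrum E) _ _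
      infer_instance
    exact .of_comp (fromGeneric C.left) t
  have htsurj : Surjective t :=
    surjective_of_isDominant_of_isClosed_range _ t.isClosedMap.isClosed_range
  have hded : ∀ x : normalizationIn D.left E, ∃ U : (normalizationIn D.left E).Opens,
      IsAffineOpen U ∧ IsDedekindDomain Γ(normalizationIn D.left E, U) ∧ x ∈ U := by
    intro x
    obtain ⟨_, ⟨U, hU, rfl⟩, hxU, -⟩ := D.left.isBasis_affineOpens.exists_subset_of_mem_open
      (Set.mem_univ (normalizationInMap D.left E x)) isOpen_univ
    have hne : Nonempty U := ⟨⟨_, hxU⟩⟩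
    have := IsCurve.isDedekindDomain U hU hne
    exact ⟨normalizationInMap D.left E ⁻¹ᵁ U, hU.preimage _,
      (isDedekindDomain_normalizationIn E hU).1, hxU⟩
  let X : Over (Spec (CommRingCat.of K)) := Over.mk (normalizationInMap D.left E ≫ D.hom)
  let h : X ⟶ D := Over.homMk (normalizationInMap D.left E) rfl
  let g : C ⟶ X := Over.homMk t (by
    change t ≫ normalizationInMap D.left E ≫ D.hom = C.hom
    rw [reassoc_of% ht, Over.w])
  have hgh : g ≫ h = f := Over.OverMorphism.ext ht
  have hg : IsNonconstant g := fun ⟨y, hy⟩ => hf ⟨normalizationInMap D.left E y, fun x => by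
    rw [← ht, Scheme.Hom.comp_apply]
    exact congrArg _ (hy x)⟩
  have hh : IsNonconstant h := fun ⟨y, hy⟩ => hf ⟨y, fun x => by
    rw [← ht, Scheme.Hom.comp_apply]
    exact hy _⟩
  have hXint : IsIntegral X.left := inferInstanceAs (IsIntegral (normalizationIn D.left E))
  have hXproper : IsProper X.hom :=
    inferInstanceAs (IsProper (normalizationInMap D.left E ≫ D.hom))
  -- A one-point `X` would make g constant; this gives the lower bound on the dimension.
  have hXnontriv : Nontrivial X.left := by
    by_contra hcon
    rw [not_nontrivial_iff_subsingleton] at hcon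
    exact hg ⟨g.left (genericPoint C.left), fun x => Subsingleton.elim _ _⟩
  have hX : IsCurve X :=
    { integral := hXint
      dim_eq_one := topologicalKrullDim_eq_one (fun x => by
        obtain ⟨U, hU, hUD, hx⟩ := hded x
        exact coheight_le_one_of_isDedekindDomain hU hUD hx) hXnontriv
      nonsingular := fun x => by
        obtain ⟨U, hU, hUD, hx⟩ := hded x
        exact isRegularLocalRing_stalk_of_isDedekindDomain hU hUD hx
      geometricallyIrreducible := by
        have : GeometricallyIrreducible (t ≫ X.hom) := by
          have hw : t ≫ X.hom = C.hom := Over.w g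
          rw [hw]
          exact hC.geometricallyIrreducible
        exact geometricallyIrreducible_of_surjective t X.hom
      projective := by
        obtain ⟨n, i, hi⟩ := hD.projective
        have : IsAffineHom (h ≫ i).left := by
          rw [Over.comp_left]
          change IsAffineHom (normalizationInMap D.left E ≫ i.left)
          infer_instance
        exact exists_isClosedImmersion_of_isAffineHom (h ≫ i) }
  refine ⟨X, hX, g, h, hg, hh, σ, hgh, hσ, ?_, ?_⟩
  · apply functionFieldMap_eq_of_comp_eq
    rw [CommRingCat.ofHom_comp, Spec.map_comp, Category.assoc]
    exact (congrArg (Spec.map (CommRingCat.ofHom j) ≫ ·) hσ').trans ht'.symm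
  · have h1 := Spec_map_functionFieldMap h hh
    have h2 : Spec.map (CommRingCat.ofHom (σ.comp (functionFieldMap h hh))) ≫ fromGeneric D.left =
        genericPointMap D.left E := by
      rw [CommRingCat.ofHom_comp, Spec.map_comp, Category.assoc, h1, ← Category.assoc]
      refine (congrArg (· ≫ normalizationInMap D.left E) hσ').trans ?_
      exact Scheme.Hom.toNormalization_fromNormalization _
    rw [genericPointMap, cancel_mono] at h2
    exact congrArg CommRingCat.Hom.hom (Spec.map_injective h2)

end Intermediate

/-! ### Indecomposable covers and equivalence of decompositions -/

/-- The function field of a constructed curve is only isomorphic to the intermediate field, so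
separability and degrees must be transported along σ. -/
theorem isSeparable_and_finrank_eq_of_bijective {F L M X : Type*} [Field F] [Field L] [Field M]
    [Field X] [Algebra F L] [Algebra L M] [Algebra F M] [IsScalarTower F L M]
    [Algebra.IsSeparable F M] (σ : X →+* L) (hσ : Function.Bijective σ) (g : X →+* M) (k : F →+* X)
    (hg : g = (algebraMap L M).comp σ) (hk : σ.comp k = algebraMap F L) :
    (letI := g.toAlgebra; Algebra.IsSeparable X M ∧ Module.finrank X M = Module.finrank L M) ∧
    (letI := k.toAlgebra; Algebra.IsSeparable F X ∧ Module.finrank F X = Module.finrank F L) := by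
  let a₁ := g.toAlgebra
  let a₂ := k.toAlgebra
  let e := RingEquiv.ofBijective σ hσ
  have := Algebra.isSeparable_tower_top_of_isSeparable F L M
  have := Algebra.isSeparable_tower_bot_of_isSeparable F L M
  have he₁ : (algebraMap X M).comp e.symm.toRingHom =
      (RingEquiv.refl M).toRingHom.comp (algebraMap L M) := by
    ext x
    obtain ⟨y, rfl⟩ := e.surjective x
    exact (congrArg g (e.symm_apply_apply y)).trans congr($hg y)
  have he₂ : (algebraMap F X).comp (RingEquiv.refl F).toRingHom =
      e.symm.toRingHom.comp (algebraMap F L) := by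
    ext x
    apply e.injective
    exact congr($hk x).trans (e.apply_symm_apply _).symm
  exact ⟨⟨.of_equiv_equiv e.symm (.refl _) he₁,
    (Algebra.finrank_eq_of_equiv_equiv e.symm (.refl _) he₁).symm⟩,
    .of_equiv_equiv (.refl _) e.symm he₂,
    (Algebra.finrank_eq_of_equiv_equiv (.refl _) e.symm he₂).symm⟩

section Decomposition

variable {K : Type u} [Field K] {C D E B : Over (Spec (CommRingCat.of K))} [hC : IsCurve C]
  [hD : IsCurve D] [hE : IsCurve E] [hB : IsCurve B]

theorem IsIndecomposable.finiteDimensional {f : C ⟶ D} [hf : IsCover f] (h : IsIndecomposable f) :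
    letI := functionFieldAlgebra f hf.nonconstant
    FiniteDimensional D.left.functionField C.left.functionField := by
  let := functionFieldAlgebra f hf.nonconstant
  -- `Module.finrank` is 0 for an infinite extension, so degree at least 2 already forces
  -- finiteness.
  refine Module.finite_of_finrank_pos ?_
  have : 2 ≤ Module.finrank D.left.functionField C.left.functionField := h.1
  omega

/-- The function field extension of an indecomposable cover has no proper intermediate fields. -/
theorem IsIndecomposable.eq_bot_or_eq_top {f : C ⟶ D} [hf : IsCover f] (h : IsIndecomposable f) :
    letI := functionFieldAlgebra f hf.nonconstant
    ∀ L : IntermediateField D.left.functionField C.left.functionField, L = ⊥ ∨ L = ⊤ := by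
  let := functionFieldAlgebra f hf.nonconstant
  intro L
  have hfin : FiniteDimensional D.left.functionField C.left.functionField := h.finiteDimensional
  have hsep : Algebra.IsSeparable D.left.functionField C.left.functionField := hf.separable
  by_contra! hL
  obtain ⟨X, hX, g, k, hg, hk, σ, hgk, hσ, h1, h2⟩ := exists_isCurve_of_functionField f
    hf.nonconstant L (algebraMap L C.left.functionField)
    (IsScalarTower.algebraMap_eq D.left.functionField L C.left.functionField).symm
  obtain ⟨⟨hs₁, hr₁⟩, hs₂, hr₂⟩ := isSeparable_and_finrank_eq_of_bijective σ hσ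
    (functionFieldMap g hg) (functionFieldMap k hk) h1 h2
  have hcg : IsCover g := ⟨hg, hs₁⟩
  have hck : IsCover k := ⟨hk, hs₂⟩
  have hdg : degree g = Module.finrank L C.left.functionField := hr₁
  have hdk : degree k = Module.finrank D.left.functionField L := hr₂
  refine h.2 ⟨X, hX, g, k, hcg, hck, hgk, ?_, ?_⟩
  · rw [hdg]
    have h0 : 0 < Module.finrank L C.left.functionField := Module.finrank_pos
    have h3 : Module.finrank L C.left.functionField ≠ 1 := fun h =>
      hL.2 (IntermediateField.finrank_eq_one_iff_eq_top.mp h)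
    omega
  · rw [hdk]
    have h0 : 0 < Module.finrank D.left.functionField L := Module.finrank_pos
    have h3 : Module.finrank D.left.functionField L ≠ 1 := fun h =>
      hL.1 (IntermediateField.finrank_eq_one_iff.mp h)
    omega

theorem IsNonconstant.isDominant {f : C ⟶ D} (hf : IsNonconstant f) : IsDominant f.left := by
  have : Surjective (Spec.map (CommRingCat.ofHom (functionFieldMap f hf))) :=
    ⟨fun x => ⟨IsLocalRing.closedPoint C.left.functionField,
      Subsingleton.elim (α := PrimeSpectrum D.left.functionField) _ _⟩⟩
  have : IsDominant (fromGeneric C.left ≫ f.left) := by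
    rw [← Spec_map_functionFieldMap f hf]
    infer_instance
  exact .of_comp (fromGeneric C.left) f.left

/-- Dominance makes nonconstant morphisms epimorphic here, since curves are reduced and separated.
-/
theorem IsNonconstant.hom_ext {f : C ⟶ D} (hf : IsNonconstant f) {g h : D ⟶ E}
    (hgh : f ≫ g = f ≫ h) : g = h := by
  have := hf.isDominant
  refine Over.OverMorphism.ext ?_
  refine ext_of_isDominant_of_isSeparated E.hom ((Over.w g).trans (Over.w h).symm) f.left ?_
  exact congr($(hgh).left)

/-- A containment of intermediate function fields is induced by a morphism of the intermediate
curves. -/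
theorem exists_hom_of_range_le {f₁ : C ⟶ E} {f₂ : E ⟶ D} {g₁ : C ⟶ B} {g₂ : B ⟶ D}
    (hf₁ : IsNonconstant f₁) (hf₂ : IsNonconstant f₂) (hg₁ : IsNonconstant g₁)
    (hg₂ : IsNonconstant g₂) (hf : IsNonconstant (f₁ ≫ f₂)) (h : g₁ ≫ g₂ = f₁ ≫ f₂)
    (hle : (functionFieldMap g₁ hg₁).fieldRange ≤ (functionFieldMap f₁ hf₁).fieldRange) :
    ∃ ρ : E ⟶ B, g₁ = f₁ ≫ ρ ∧ ρ ≫ g₂ = f₂ := by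
  -- τ is g₁* followed by the inverse of f₁* on its image. Finiteness of g₂ and normality of `E`
  -- then turn it into a morphism.
  obtain ⟨τ, hτ⟩ : ∃ τ : B.left.functionField →+* E.left.functionField,
      (functionFieldMap f₁ hf₁).comp τ = functionFieldMap g₁ hg₁ := by
    have hmem : ∀ x, functionFieldMap g₁ hg₁ x ∈ (functionFieldMap f₁ hf₁).range :=
      fun x => hle ⟨x, rfl⟩
    let e := RingEquiv.ofBijective (functionFieldMap f₁ hf₁).rangeRestrict
      ⟨fun x y hxy => (functionFieldMap f₁ hf₁).injective (Subtype.ext_iff.mp hxy),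
        (functionFieldMap f₁ hf₁).rangeRestrict_surjective⟩
    refine ⟨e.symm.toRingHom.comp ((functionFieldMap g₁ hg₁).codRestrict _ hmem),
      RingHom.ext fun x => ?_⟩
    exact congr(($(e.apply_symm_apply ((functionFieldMap g₁ hg₁).codRestrict _ hmem x))).1)
  have hτ₂ : τ.comp (functionFieldMap g₂ hg₂) = functionFieldMap f₂ hf₂ := by
    have h1 := functionFieldMap_comp f₁ f₂ hf₁ hf₂ hf
    have h2 : functionFieldMap (f₁ ≫ f₂) hf =
        (functionFieldMap g₁ hg₁).comp (functionFieldMap g₂ hg₂) := by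
      rw [← functionFieldMap_comp g₁ g₂ hg₁ hg₂ (h ▸ hf)]
      simp only [h]
    ext x
    apply (functionFieldMap f₁ hf₁).injective
    rw [h1, ← hτ] at h2
    exact congr($h2 x).symm
  have hfin : IsFinite g₂.left := hg₂.isFinite
  have hmap : Spec.map (CommRingCat.ofHom τ) ≫
      Spec.map (CommRingCat.ofHom (functionFieldMap g₂ hg₂)) =
      Spec.map (CommRingCat.ofHom (functionFieldMap f₂ hf₂)) :=
    (Spec.map_comp _ _).symm.trans (congrArg (fun θ => Spec.map (CommRingCat.ofHom θ)) hτ₂)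
  obtain ⟨t, ht, ht'⟩ := exists_lift_of_isIntegralHom (X := E.left)
    (fun U hU hne => by
      have := IsCurve.isDedekindDomain U hU hne
      infer_instance)
    g₂.left f₂.left (Spec.map (CommRingCat.ofHom τ) ≫ fromGeneric B.left) (by
      rw [Category.assoc, ← Spec_map_functionFieldMap g₂ hg₂, ← Spec_map_functionFieldMap f₂ hf₂,
        ← Category.assoc]
      exact congrArg (· ≫ fromGeneric D.left) hmap)
  let ρ : E ⟶ B := Over.homMk t (by rw [← Over.w g₂, reassoc_of% ht, Over.w])
  have hρ : ρ ≫ g₂ = f₂ := Over.OverMorphism.ext ht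
  refine ⟨ρ, Over.OverMorphism.ext ?_, hρ⟩
  refine ext_of_isDominant_of_isSeparated B.hom ((Over.w g₁).trans (Over.w (f₁ ≫ ρ)).symm)
    (fromGeneric C.left) ?_
  have hmap₁ : Spec.map (CommRingCat.ofHom (functionFieldMap f₁ hf₁)) ≫
      Spec.map (CommRingCat.ofHom τ) = Spec.map (CommRingCat.ofHom (functionFieldMap g₁ hg₁)) :=
    (Spec.map_comp _ _).symm.trans (congrArg (fun θ => Spec.map (CommRingCat.ofHom θ)) hτ)
  rw [← Spec_map_functionFieldMap g₁ hg₁, Over.comp_left, ← Category.assoc,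
    ← Spec_map_functionFieldMap f₁ hf₁, Category.assoc]
  refine Eq.trans ?_ (congrArg (_ ≫ ·) ht'.symm)
  rw [← Category.assoc]
  exact congrArg (· ≫ fromGeneric B.left) hmap₁.symm

/-- Decompositions with the same intermediate function field are equivalent. -/
theorem areEquivalent_of_fieldRange_eq {f₁ : C ⟶ E} {f₂ : E ⟶ D} {g₁ : C ⟶ B} {g₂ : B ⟶ D}
    (hf₁ : IsNonconstant f₁) (hf₂ : IsNonconstant f₂) (hg₁ : IsNonconstant g₁)
    (hg₂ : IsNonconstant g₂) (hf : IsNonconstant (f₁ ≫ f₂)) (h : g₁ ≫ g₂ = f₁ ≫ f₂)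
    (heq : (functionFieldMap f₁ hf₁).fieldRange = (functionFieldMap g₁ hg₁).fieldRange) :
    AreEquivalent f₁ f₂ g₁ g₂ := by
  obtain ⟨ρ, h₁, h₂⟩ := exists_hom_of_range_le hf₁ hf₂ hg₁ hg₂ hf h heq.ge
  obtain ⟨ρ', h₁', -⟩ := exists_hom_of_range_le hg₁ hg₂ hf₁ hf₂ (h ▸ hf) h.symm heq.le
  refine ⟨⟨ρ, ρ', hf₁.hom_ext ?_, hg₁.hom_ext ?_⟩, h₁, h₂⟩
  · rw [← Category.assoc, ← h₁, ← h₁', Category.comp_id]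
  · rw [← Category.assoc, ← h₁', ← h₁, Category.comp_id]

end Decomposition

/-! ### Two maximal chains of length two of intermediate fields -/

section Lattice

variable {F L M : Type*} [Field F] [Field L] [Field M] [Algebra F L] [Algebra F M] [Algebra L M]
  [IsScalarTower F L M]

theorem eq_bot_or_eq_of_le_fieldRange (h : ∀ E : IntermediateField F L, E = ⊥ ∨ E = ⊤)
    {E : IntermediateField F M} (hE : E ≤ (IsScalarTower.toAlgHom F L M).fieldRange) :
    E = ⊥ ∨ E = (IsScalarTower.toAlgHom F L M).fieldRange := by
  rcases h (E.comap (IsScalarTower.toAlgHom F L M)) with h | h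
  · refine Or.inl (le_bot_iff.mp fun x hx => ?_)
    obtain ⟨y, rfl⟩ := hE hx
    have hy : y ∈ E.comap (IsScalarTower.toAlgHom F L M) := hx
    rw [h, IntermediateField.mem_bot] at hy
    obtain ⟨c, rfl⟩ := hy
    exact IntermediateField.mem_bot.mpr ⟨c, ((IsScalarTower.toAlgHom F L M).commutes c).symm⟩
  · refine Or.inr (le_antisymm hE ?_)
    rintro _ ⟨y, rfl⟩
    exact (h ▸ IntermediateField.mem_top : y ∈ E.comap (IsScalarTower.toAlgHom F L M))

theorem eq_or_eq_top_of_fieldRange_le (h : ∀ E : IntermediateField L M, E = ⊥ ∨ E = ⊤)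
    {E : IntermediateField F M} (hE : (IsScalarTower.toAlgHom F L M).fieldRange ≤ E) :
    E = (IsScalarTower.toAlgHom F L M).fieldRange ∨ E = ⊤ := by
  let E' : IntermediateField L M := E.toSubfield.toIntermediateField fun y => hE ⟨y, rfl⟩
  rcases h E' with h | h
  · refine Or.inl (le_antisymm (fun x hx => ?_) hE)
    have hx' : x ∈ E' := hx
    rw [h, IntermediateField.mem_bot] at hx'
    obtain ⟨y, rfl⟩ := hx'
    exact ⟨y, rfl⟩
  · refine Or.inr (top_le_iff.mp fun x _ => ?_)
    exact (h ▸ IntermediateField.mem_top : x ∈ E')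

theorem fieldRange_ne_bot (h : 2 ≤ Module.finrank F L) :
    (IsScalarTower.toAlgHom F L M).fieldRange ≠ ⊥ := by
  intro hbot
  have hr : Module.finrank F (IsScalarTower.toAlgHom F L M).fieldRange = Module.finrank F L :=
    (AlgEquiv.ofInjectiveField (IsScalarTower.toAlgHom F L M)).toLinearEquiv.finrank_eq.symm
  rw [IntermediateField.finrank_eq_one_iff.mpr hbot] at hr
  omega

end Lattice

/-- The theorem on two inequivalent complete decompositions, for fields. -/
theorem permIsomorphic_galoisPermGroup_of_simple {F L₁ L₂ M : Type*} [Field F] [Field L₁] [Field L₂]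
    [Field M] [Algebra F L₁] [Algebra F L₂] [Algebra F M] [Algebra L₁ M] [Algebra L₂ M]
    [IsScalarTower F L₁ M] [IsScalarTower F L₂ M] [FiniteDimensional F M]
    [Algebra.IsSeparable F M] (hM : HasTransitiveDedekindSubgroup (galoisPermGroup F M))
    (h₁ : ∀ E : IntermediateField F L₁, E = ⊥ ∨ E = ⊤)
    (h₁' : ∀ E : IntermediateField L₁ M, E = ⊥ ∨ E = ⊤)
    (h₂ : ∀ E : IntermediateField F L₂, E = ⊥ ∨ E = ⊤)
    (hd₁ : 2 ≤ Module.finrank F L₁) (hd₂ : 2 ≤ Module.finrank F L₂)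
    (hne : (IsScalarTower.toAlgHom F L₁ M).fieldRange ≠ (IsScalarTower.toAlgHom F L₂ M).fieldRange) :
    PermIsomorphic (galoisPermGroup F L₁) (galoisPermGroup L₂ M) := by
  have hle : ¬ (IsScalarTower.toAlgHom F L₁ M).fieldRange ≤
      (IsScalarTower.toAlgHom F L₂ M).fieldRange := fun h =>
    (eq_bot_or_eq_of_le_fieldRange h₂ h).elim (fieldRange_ne_bot hd₁) hne
  have hle' : ¬ (IsScalarTower.toAlgHom F L₂ M).fieldRange ≤
      (IsScalarTower.toAlgHom F L₁ M).fieldRange := fun h =>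
    (eq_bot_or_eq_of_le_fieldRange h₁ h).elim (fieldRange_ne_bot hd₂) hne.symm
  -- Neither field contains the other, so simplicity of L₁/F gives intersection `F`, and simplicity
  -- of M/L₁ gives compositum `M`.
  refine permIsomorphic_galoisPermGroup hM ?_ ?_
  · exact (eq_bot_or_eq_of_le_fieldRange h₁ inf_le_left).resolve_right fun h =>
      hle (inf_eq_left.mp h)
  · exact (eq_or_eq_top_of_fieldRange_le h₁' le_sup_left).resolve_left fun h =>
      hle' (sup_eq_left.mp h)

/-- One of the two isomorphisms of monodromy groups for inequivalent complete decompositions. -/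
theorem permIsomorphic_mon {K : Type u} [Field K] {C D C₁ B₁ : Over (Spec (CommRingCat.of K))}
    [IsCurve C] [IsCurve D] [IsCurve C₁] [IsCurve B₁]
    (φ : C ⟶ D) (φ₁ : C ⟶ C₁) (φ₂ : C₁ ⟶ D) (ψ₁ : C ⟶ B₁) (ψ₂ : B₁ ⟶ D)
    [hφ : IsCover φ] [hφ₁ : IsCover φ₁] [hφ₂ : IsCover φ₂] [hψ₁ : IsCover ψ₁] [hψ₂ : IsCover ψ₂]
    (hMon : HasTransitiveDedekindSubgroup (Mon φ)) (h : IsCompleteDecomposition φ φ₁ φ₂)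
    (h' : IsCompleteDecomposition φ ψ₁ ψ₂) (hne : ¬ AreEquivalent φ₁ φ₂ ψ₁ ψ₂) :
    PermIsomorphic (Mon φ₂) (Mon ψ₁) := by
  let a := functionFieldAlgebra φ hφ.nonconstant
  let a₁ := functionFieldAlgebra φ₁ hφ₁.nonconstant
  let a₂ := functionFieldAlgebra φ₂ hφ₂.nonconstant
  let b₁ := functionFieldAlgebra ψ₁ hψ₁.nonconstant
  let b₂ := functionFieldAlgebra ψ₂ hψ₂.nonconstant
  have hcomp : ∀ {X : Over (Spec (CommRingCat.of K))} [IsCurve X] (f : C ⟶ X) (g : X ⟶ D)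
      (hf : IsNonconstant f) (hg : IsNonconstant g), f ≫ g = φ →
      functionFieldMap φ hφ.nonconstant = (functionFieldMap f hf).comp (functionFieldMap g hg) := by
    intro X _ f g hf hg hfg
    subst hfg
    exact functionFieldMap_comp f g hf hg _
  have t₁ : IsScalarTower D.left.functionField C₁.left.functionField C.left.functionField :=
    .of_algebraMap_eq' (hcomp φ₁ φ₂ _ _ h.comp_eq)
  have t₂ : IsScalarTower D.left.functionField B₁.left.functionField C.left.functionField :=
    .of_algebraMap_eq' (hcomp ψ₁ ψ₂ _ _ h'.comp_eq)
  have hfin₁ : FiniteDimensional C₁.left.functionField C.left.functionField :=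
    h.indecomposable_fst.finiteDimensional
  have hfin₂ : FiniteDimensional D.left.functionField C₁.left.functionField :=
    h.indecomposable_snd.finiteDimensional
  have hfin : FiniteDimensional D.left.functionField C.left.functionField :=
    .trans D.left.functionField C₁.left.functionField C.left.functionField
  have hsep : Algebra.IsSeparable D.left.functionField C.left.functionField := hφ.separable
  refine permIsomorphic_galoisPermGroup_of_simple hMon h.indecomposable_snd.eq_bot_or_eq_top
    h.indecomposable_fst.eq_bot_or_eq_top h'.indecomposable_snd.eq_bot_or_eq_top
    h.indecomposable_snd.1 h'.indecomposable_snd.1 fun heq => hne ?_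
  refine areEquivalent_of_fieldRange_eq hφ₁.nonconstant hφ₂.nonconstant hψ₁.nonconstant
    hψ₂.nonconstant (h.comp_eq ▸ hφ.nonconstant) (h'.comp_eq.trans h.comp_eq.symm) ?_
  exact congrArg IntermediateField.toSubfield heq

end CurveCover

end

theorem proposition5p2 {K : Type u} [Field K]
    {C D C₁ B₁ : Over (Spec (CommRingCat.of K))}
    [CurveCover.IsCurve C] [CurveCover.IsCurve D] [CurveCover.IsCurve C₁] [CurveCover.IsCurve B₁]
    (φ : C ⟶ D) (φ₁ : C ⟶ C₁) (φ₂ : C₁ ⟶ D) (ψ₁ : C ⟶ B₁) (ψ₂ : B₁ ⟶ D)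
    [CurveCover.IsCover φ] [CurveCover.IsCover φ₁] [CurveCover.IsCover φ₂]
    [CurveCover.IsCover ψ₁] [CurveCover.IsCover ψ₂]
    (hMon : CurveCover.HasTransitiveDedekindSubgroup (CurveCover.Mon φ))
    (hφ : CurveCover.IsCompleteDecomposition φ φ₁ φ₂)
    (hψ : CurveCover.IsCompleteDecomposition φ ψ₁ ψ₂)
    (hne : ¬ CurveCover.AreEquivalent φ₁ φ₂ ψ₁ ψ₂) :
    CurveCover.PermIsomorphic (CurveCover.Mon φ₂) (CurveCover.Mon ψ₁) ∧
      CurveCover.PermIsomorphic (CurveCover.Mon φ₁) (CurveCover.Mon ψ₂) := by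
  -- The second isomorphism is the first with the two decompositions exchanged; inequivalence is
  -- symmetric by inverting ρ.
  refine ⟨CurveCover.permIsomorphic_mon φ φ₁ φ₂ ψ₁ ψ₂ hMon hφ hψ hne,
    (CurveCover.permIsomorphic_mon φ ψ₁ ψ₂ φ₁ φ₂ hMon hψ hφ ?_).symm⟩
  rintro ⟨ρ, h₁, h₂⟩
  exact hne ⟨ρ.symm, by rw [h₁, Category.assoc, Iso.symm_hom, Iso.hom_inv_id, Category.comp_id],
    by rw [← h₂, Iso.symm_hom, Iso.inv_hom_id_assoc]⟩
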